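/- **Notation.** Let $\mathcal H_n=\otimes^n\mathbb C^2$ be the space of $n$ qubits. For $[v]\in\mathbb P^1=\mathbb P(\mathbb C^2)$ let $[\hat v]$ be the line perpendicular to $[v]$. Let $Q_n$ be the hypercube graph with vertex set $\{0,1\}^n$. Let $\mathcal U_n\subset\mathbb P(\mathcal H_n)^{2^n}$ be the set of unentangled orthogonal bases (UOB), i.e. of $2^n$-tuples $(u_s)_{s\in\{0,1\}^n}$ of pairwise orthogonal product states $u_s=[u_{1s}]\otimes\cdots\otimes[u_{ns}]$, regarded as a real algebraic variety: it carries the real Zariski topology, where $\mathbb P(\mathcal H_n)$ is identified with the set of rank-one orthogonal projections. Dimension is Krull dimension. For a coloring $C$ of the edges of $Q_n$ with $k$ colors, the color of the $i$-th component of a vertex $s$ is the color of the edge from $s$ to the vertex that differs from $s$ exactly in position $i$. Define $\Phi_C\colon(\mathbb P^1)^k\to\mathbb P(\mathcal H_n)^{2^n}$ by letting the $i$-th factor of the state at the vertex $s$ be $[u_r]$ if $s_i=0$ and $[\hat u_r]$ if $s_i=1$, where $r$ is the color of the $i$-th component of $s$. The colorings *produced by the algorithm* are defined recursively. The empty coloring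 of $Q_0$ is produced. A coloring of $Q_{n}$, $n\ge1$, is produced if there are two colorings $C_0,C_1$ of $Q_{n-1}$, each obtained from a coloring produced by the algorithm by a permutation of the $n-1$ coordinates, which have no color in common, and a color $c$ used in neither, such that all edges in the first direction have color $c$ and the subcubes $0\times Q_{n-1}$ and $1\times Q_{n-1}$ are colored as $C_0$ and $C_1$ respectively. **Theorem.** 1. For every $n$, the irreducible components of maximum dimension of $\mathcal U_n$ are exactly the sets obtained from the images of $\Phi_C$, with $C$ a coloring of $Q_n$ produced by the algorithm, by a permutation of the $n$ tensor factors and a reordering of the $2^n$ members of the bases. 2. For $n\ge1$, every irreducible component $\mathcal B$ of maximum dimension of $\mathcal U_n$ can be written, after a permutation of the tensor factors and a reordering of the members of the bases, as $$\mathcal B=\{[a]\otimes\mathcal B_1,\ [\hat a]\otimes\mathcal B_2\},$$ the set of all bases that consist of the $[a]\otimes w$ with $w$ in a basis from $\mathcal B_1$ and the $[\hat a]\otimes w$ with $w$ in a basis from $\mathcal B_2$, where $[a]\in\mathbb P^1$ and the members of $\mathcal B_1$ and $\mathcal B_2$ are chosen arbitrarily and independently. Here $\mathcal B_1,\mathcal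 B_2$ are irreducible components of maximum dimension of $\mathcal U_{n-1}$, namely the images of $\Phi_{C_1},\Phi_{C_2}$ for colorings $C_1,C_2$ of $Q_{n-1}$ which, up to a permutation of the coordinates, are produced by the algorithm. -/

import Mathlib

noncomputable section

namespace Qubits

open scoped LinearAlgebra.Projectivization

/-! ### Qubits, product states, real Zariski topology -/

/-- Vertices of the hypercube `Q_n`: binary strings of length `n`. They also index the standard
basis of the space of `n` qubits, and the members of an (ordered) orthogonal basis. -/
abbrev Vertex (n : ℕ) : Type := Fin n → Fin 2

/-- One qubit, `ℂ²` with its standard Hermitian inner product. -/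
abbrev Qubit : Type := EuclideanSpace ℂ (Fin 2)

/-- The space of `n` qubits `⊗ⁿ ℂ²`, with the tensor product Hilbert structure, in the orthonormal
basis of tensor products `e_{s 0} ⊗ ⋯ ⊗ e_{s (n-1)}` of standard basis vectors. -/
abbrev Space (n : ℕ) : Type := EuclideanSpace ℂ (Vertex n)

/-- The pure tensor `v_0 ⊗ ⋯ ⊗ v_{n-1}`. -/
def pureTensor {n : ℕ} (v : Fin n → Qubit) : Space n :=
  WithLp.toLp 2 fun s => ∏ i, v i (s i)

/-- The tensor `v ⊗ w` of a qubit vector and an `n`-qubit vector, as an `(n+1)`-qubit vector. -/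
def consTensor {n : ℕ} (v : Qubit) (w : Space n) : Space (n + 1) :=
  WithLp.toLp 2 fun s => v (s 0) * w (Fin.tail s)

/-- For `v ∈ ℂ²`, a vector orthogonal to `v` and of the same length. -/
def perp (v : Qubit) : Qubit := !₂[-(starRingEnd ℂ) (v 1), (starRingEnd ℂ) (v 0)]

theorem exists_coord_ne_zero {ι : Type*} {v : EuclideanSpace ℂ ι} (h : v ≠ 0) :
    ∃ i, v i ≠ 0 := by
  by_contra! H
  exact h (by ext i; simpa using H i)

theorem pureTensor_ne_zero {n : ℕ} {v : Fin n → Qubit} (h : ∀ i, v i ≠ 0) :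
    pureTensor v ≠ 0 := by
  choose s hs using fun i => exists_coord_ne_zero (h i)
  intro H
  have h1 : pureTensor v s = 0 := by rw [H]; rfl
  have h2 : ∏ i, v i (s i) = 0 := h1
  exact (Finset.prod_ne_zero_iff.mpr fun i _ => hs i) h2

theorem consTensor_ne_zero {n : ℕ} {v : Qubit} {w : Space n} (hv : v ≠ 0) (hw : w ≠ 0) :
    consTensor v w ≠ 0 := by
  obtain ⟨i, hi⟩ := exists_coord_ne_zero hv
  obtain ⟨t, ht⟩ := exists_coord_ne_zero hw
  intro H
  have h1 : consTensor v w (Fin.cons i t) = 0 := by rw [H]; rfl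
  simp [consTensor, hi, ht] at h1

theorem perp_ne_zero {v : Qubit} (h : v ≠ 0) : perp v ≠ 0 := by
  obtain ⟨i, hi⟩ := exists_coord_ne_zero h
  intro H
  have h0 : perp v 0 = 0 := by rw [H]; rfl
  have h1 : perp v 1 = 0 := by rw [H]; rfl
  fin_cases i
  · exact hi (by simpa [perp] using h1)
  · exact hi (by simpa [perp] using h0)

/-- The product state `[v_0] ⊗ ⋯ ⊗ [v_{n-1}]` (up to phase). -/
def productState {n : ℕ} (x : Fin n → ℙ ℂ Qubit) : ℙ ℂ (Space n) :=
  Projectivization.mk ℂ (pureTensor fun i => (x i).rep)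
    (pureTensor_ne_zero fun i => (x i).rep_nonzero)

/-- `[a] ⊗ [w]` for a qubit state `[a]` and an `n`-qubit state `[w]`. -/
def consState {n : ℕ} (a : ℙ ℂ Qubit) (w : ℙ ℂ (Space n)) : ℙ ℂ (Space (n + 1)) :=
  Projectivization.mk ℂ (consTensor a.rep w.rep) (consTensor_ne_zero a.rep_nonzero w.rep_nonzero)

/-- The involution `[v] ↦ [v̂]` of `ℙ¹`: the line perpendicular to `[v]`. -/
def hat (p : ℙ ℂ Qubit) : ℙ ℂ Qubit :=
  Projectivization.mk ℂ (perp p.rep) (perp_ne_zero p.rep_nonzero)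

/-- `2ⁿ`-tuples of elements of the projective space of `n` qubits. -/
def Tuples (n : ℕ) : Type := Vertex n → ℙ ℂ (Space n)

/-- The entry `(a, b)` of the orthogonal projection onto the line `p`. The projective space, as a
real algebraic variety, is embedded in the Hermitian matrices through these projections. -/
def projEntry {n : ℕ} (p : ℙ ℂ (Space n)) (a b : Vertex n) : ℂ :=
  p.rep a * (starRingEnd ℂ) (p.rep b) / ((‖p.rep‖ ^ 2 : ℝ) : ℂ)

/-- Names of the real coordinates on `Tuples n`: real parts (`inl`) and imaginary parts (`inr`) of
the entries of the `2ⁿ` projections. -/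
abbrev CoordIndex (n : ℕ) : Type :=
  (Vertex n × Vertex n × Vertex n) ⊕ (Vertex n × Vertex n × Vertex n)

/-- The real coordinates of a tuple of lines. -/
def realCoord {n : ℕ} (u : Tuples n) : CoordIndex n → ℝ :=
  Sum.elim (fun j => (projEntry (u j.1) j.2.1 j.2.2).re)
    (fun j => (projEntry (u j.1) j.2.1 j.2.2).im)

/-- The set of tuples of lines on which a set of real polynomials vanishes. -/
def zeroSet {n : ℕ} (P : Set (MvPolynomial (CoordIndex n) ℝ)) : Set (Tuples n) :=
  {u | ∀ p ∈ P, MvPolynomial.eval (realCoord u) p = 0}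

/-- The (real) Zariski topology on `Tuples n`: closed sets are the real algebraic subsets. -/
instance zariski (n : ℕ) : TopologicalSpace (Tuples n) :=
  TopologicalSpace.ofClosed {Z | ∃ P, Z = zeroSet P}
    ⟨{1}, by ext u; simp [zeroSet]⟩
    (by
      intro A hA
      refine ⟨{p | ∃ P, zeroSet P ∈ A ∧ p ∈ P}, ?_⟩
      ext u
      constructor
      · rintro hu p ⟨P, hP, hp⟩
        exact hu _ hP p hp
      · intro hu Z hZ
        obtain ⟨P, rfl⟩ := hA hZ
        exact fun p hp => hu p ⟨P, hZ, hp⟩)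
    (by
      rintro _ ⟨P, rfl⟩ _ ⟨R, rfl⟩
      refine ⟨{f | ∃ p ∈ P, ∃ r ∈ R, f = p * r}, ?_⟩
      ext u
      constructor
      · rintro (hu | hu) _ ⟨p, hp, r, hr, rfl⟩
        · simp [hu p hp]
        · simp [hu r hr]
      · intro hu
        by_contra H
        simp only [Set.mem_union, not_or, zeroSet, Set.mem_ofPred_eq, not_forall] at H
        obtain ⟨⟨p, hp, hp0⟩, ⟨r, hr, hr0⟩⟩ := H
        have h := hu _ ⟨p, hp, r, hr, rfl⟩
        rw [map_mul] at h
        exact (mul_ne_zero hp0 hr0) h)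

/-! ### The variety of unentangled orthogonal bases and its components -/

/-- The variety of unentangled orthogonal bases of `n` qubits: tuples of `2ⁿ` pairwise orthogonal
product states. -/
def UOB (n : ℕ) : Set (Tuples n) :=
  {u | (∀ s, ∃ x, u s = productState x) ∧
    ∀ s t, s ≠ t → (u s).submodule ⟂ (u t).submodule}

/-- The irreducible components of `UOB n`, as sets of tuples. -/
def components (n : ℕ) : Set (Set (Tuples n)) :=
  (fun Z : Set (UOB n) => Subtype.val '' Z) '' irreducibleComponents (UOB n)

/-- The irreducible components of `UOB n` of maximum dimension; the dimension of a real variety is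
its Krull dimension. -/
def maxComponents (n : ℕ) : Set (Set (Tuples n)) :=
  {Z | Z ∈ components n ∧ ∀ Y ∈ components n, topologicalKrullDim Y ≤ topologicalKrullDim Z}

/-! ### Permutation of the tensor factors and of the members of a basis -/

/-- Permutation of the tensor factors: `[v_0] ⊗ ⋯ ⊗ [v_{n-1}]` goes to the product state with
`[v_i]` in position `σ i`. -/
def permFactors {n : ℕ} (σ : Equiv.Perm (Fin n)) : ℙ ℂ (Space n) → ℙ ℂ (Space n) :=
  Projectivization.map
    (LinearIsometryEquiv.piLpCongrLeft 2 ℂ ℂ (σ.arrowCongr (Equiv.refl (Fin 2)))).toLinearMap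
    (LinearIsometryEquiv.injective _)

/-- Apply a permutation `σ` of the tensor factors to all members of a tuple, and list the members
in the order given by `τ`. -/
def rearrange {n : ℕ} (σ : Equiv.Perm (Fin n)) (τ : Equiv.Perm (Vertex n)) (u : Tuples n) :
    Tuples n :=
  fun s => permFactors σ (u (τ s))

/-- The tuple `{[a] ⊗ u, [â] ⊗ v}`. -/
def glue {n : ℕ} (a : ℙ ℂ Qubit) (u v : Tuples n) : Tuples (n + 1) :=
  fun s => if s 0 = 0 then consState a (u (Fin.tail s)) else consState (hat a) (v (Fin.tail s))

/-! ### Colorings of the hypercube -/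

/-- The hypercube graph: edges are the pairs of binary strings at Hamming distance `1`. -/
def hypercube (n : ℕ) : SimpleGraph (Vertex n) where
  Adj s t := hammingDist s t = 1
  symm := ⟨fun s t h => by rw [hammingDist_comm]; exact h⟩
  loopless := ⟨fun s h => by simp at h⟩

/-- The vertex that differs from `s` exactly in the `i`-th component. -/
def flipAt {n : ℕ} (s : Vertex n) (i : Fin n) : Vertex n := Function.update s i (s i).rev

theorem adj_flipAt {n : ℕ} (s : Vertex n) (i : Fin n) : (hypercube n).Adj s (flipAt s i) := by
  have h : (Finset.univ.filter fun j => s j ≠ flipAt s i j) = {i} := by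
    ext j
    rw [Finset.mem_filter, Finset.mem_singleton]
    constructor
    · rintro ⟨-, hj⟩
      by_contra hji
      exact hj (Function.update_of_ne hji _ _).symm
    · rintro rfl
      have hb : ∀ b : Fin 2, b ≠ b.rev := by decide
      refine ⟨Finset.mem_univ _, ?_⟩
      unfold flipAt
      rw [Function.update_self]
      exact hb _
  change hammingDist s (flipAt s i) = 1
  unfold hammingDist
  rw [h, Finset.card_singleton]

/-- Colorings of the edges of `Q_n` by colors from the palette `ℕ`. The colors of `C` are the
elements of `Set.range C`. -/
abbrev Coloring (n : ℕ) : Type := (hypercube n).edgeSet → ℕ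

/-- The color assigned to the `i`-th component of the vertex `s`: that of the edge from `s` to the
vertex differing from `s` in the `i`-th component. -/
def vertexColor {n : ℕ} (C : Coloring n) (s : Vertex n) (i : Fin n) : ℕ :=
  C ⟨s(s, flipAt s i), adj_flipAt s i⟩

/-- The automorphism `s ↦ s ∘ σ` of the hypercube given by a permutation of the coordinates. -/
def permIso {n : ℕ} (σ : Equiv.Perm (Fin n)) : hypercube n ≃g hypercube n where
  toEquiv := σ.symm.arrowCongr (Equiv.refl (Fin 2))
  map_rel_iff' := by
    intro s t
    have h : hammingDist (fun i => s (σ i)) (fun i => t (σ i)) = hammingDist s t := by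
      unfold hammingDist
      exact Finset.card_bij (fun i _ => σ i) (by simp) (by simp)
        (fun j hj => ⟨σ.symm j, by simpa using hj, by simp⟩)
    change hammingDist (fun i => s (σ i)) (fun i => t (σ i)) = 1 ↔ hammingDist s t = 1
    rw [h]

/-- A coloring of `Q_n` with permuted coordinates. -/
def permute {n : ℕ} (σ : Equiv.Perm (Fin n)) (C : Coloring n) : Coloring n :=
  fun e => C ((permIso σ).mapEdgeSet e)

/-- `Φ_C : (ℙ¹)^k → tuples`, where `k` is the number of colors of `C`: the `i`-th factor of the
state at the vertex `s` is `[u_r]` if `s i = 0` and `[û_r]` if `s i = 1`, where `r` is the color of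
the `i`-th component of `s`. -/
def Phi {n : ℕ} (C : Coloring n) (u : Set.range C → ℙ ℂ Qubit) : Tuples n :=
  fun s => productState fun i =>
    if s i = 0 then u ⟨vertexColor C s i, Set.mem_range_self _⟩
    else hat (u ⟨vertexColor C s i, Set.mem_range_self _⟩)

/-- `C` colors `Q_{n+1} = 0 × Q_n ∪ 1 × Q_n` as follows: all first components have color `c`; the
other components are colored as in `C₀` if the first index is `0`, and as in `C₁` if it is `1`. -/
def IsJoin {n : ℕ} (c : ℕ) (C₀ C₁ : Coloring n) (C : Coloring (n + 1)) : Prop :=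
  ∀ s : Vertex (n + 1), vertexColor C s 0 = c ∧
    ∀ i : Fin n, vertexColor C s i.succ =
      if s 0 = 0 then vertexColor C₀ (Fin.tail s) i else vertexColor C₁ (Fin.tail s) i

/-- The colorings of `Q_n` produced by the recursive algorithm: start with the coloring of the
edgeless `Q_0`; to color `Q_{n+1}`, join two colorings of `Q_n` produced by the algorithm (each of
them possibly after a permutation of its `n` coordinates) that have no color in common, using a new
color for the first direction. -/
def IsAlgorithmic : (n : ℕ) → Coloring n → Prop
  | 0, _ => True
  | n + 1, C => ∃ (C₀ C₁ : Coloring n) (σ₀ σ₁ : Equiv.Perm (Fin n)) (c : ℕ),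
      IsAlgorithmic n C₀ ∧ IsAlgorithmic n C₁ ∧
      Disjoint (Set.range C₀) (Set.range C₁) ∧ c ∉ Set.range C₀ ∪ Set.range C₁ ∧
      IsJoin c (permute σ₀ C₀) (permute σ₁ C₁) C

end Qubits

end

open Qubits

/-! Two product states are orthogonal exactly when in some position their factors are `p` and `hat
p` (`productState_isOrtho_iff`). In an unentangled orthogonal basis, color the `i`-th factor of each
member by the position and the unordered pair `{p, hat p}`, and record by a bit which element of the
pair occurs. Two distinct members then differ in a bit whose color is the same at both. So the bit
strings are distinct, the members are labelled by the vertices of the cube, and the colors descend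
to its edges (`exists_eq_reorder_colorTuple`, `IsSeparating.flipAt`).

Hence the variety is a finite union of pieces, one for each separating coloring and each ordering.
By `isClosedEmbedding_colorTuple` a piece is a closed copy of a product of projective lines, one for
each color; it is irreducible, and its dimension is finite and strictly increasing in the number of
colors (`Config.topologicalKrullDim_lt`). The value of the dimension is never needed. The components
of maximum dimension are the pieces with the most colors.

The count of colors is linear algebra. For a separating coloring the constant function and the
signed indicators of the pairs (direction, color) are orthogonal functions on the cube, so there are
at most `2 ^ n - 1` pairs (`IsSeparating.card_dirColor`). If this number is attained, they form an
orthogonal basis, and the completeness relation at two opposite vertices forces one color to fill a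
whole direction (`IsSeparating.exists_direction`). Removing that direction leaves two half cubes;
counting shows that each is again maximal and that no color is shared. By induction the maximal
colorings are those of the algorithm up to permuting coordinates
(`IsSeparating.exists_isAlgorithmic`). Disjointness of the palettes also gives the product form in
the second claim (`IsJoin.range_Phi_eq`). -/

noncomputable section

namespace Qubits

open scoped LinearAlgebra.Projectivization
open Topology

/-! ### Zariski topologies defined by real coordinates -/

section Zariski

variable {X Y ι κ J K : Type*}

/-- The prime ideal of the real polynomials that vanish at a point with given coordinates. -/
def evalSpec (φ : X → ι → ℝ) (x : X) : PrimeSpectrum (MvPolynomial ι ℝ) :=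
  ⟨RingHom.ker (MvPolynomial.eval (φ x)), RingHom.ker_isPrime _⟩

theorem evalSpec_preimage_zeroLocus (φ : X → ι → ℝ) (P : Set (MvPolynomial ι ℝ)) :
    evalSpec φ ⁻¹' PrimeSpectrum.zeroLocus P = {x | ∀ p ∈ P, MvPolynomial.eval (φ x) p = 0} := by
  ext x
  simp only [Set.mem_preimage, PrimeSpectrum.mem_zeroLocus, evalSpec]
  rfl

/-- The topology of `X` is the Zariski topology for the real coordinates `φ`. -/
def IsZariski [TopologicalSpace X] (φ : X → ι → ℝ) : Prop := IsInducing (evalSpec φ)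

theorem IsZariski.isClosed_iff [TopologicalSpace X] {φ : X → ι → ℝ} (h : IsZariski φ)
    {Z : Set X} :
    IsClosed Z ↔ ∃ P : Set (MvPolynomial ι ℝ), Z = {x | ∀ p ∈ P, MvPolynomial.eval (φ x) p = 0} := by
  rw [IsInducing.isClosed_iff h]
  constructor
  · rintro ⟨t, ht, rfl⟩
    obtain ⟨P, rfl⟩ := (PrimeSpectrum.isClosed_iff_zeroLocus _).1 ht
    exact ⟨P, evalSpec_preimage_zeroLocus φ P⟩
  · rintro ⟨P, rfl⟩
    exact ⟨_, PrimeSpectrum.isClosed_zeroLocus P, evalSpec_preimage_zeroLocus φ P⟩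

theorem isZariski_of_isClosed_iff [TopologicalSpace X] {φ : X → ι → ℝ}
    (h : ∀ Z : Set X, IsClosed Z ↔
      ∃ P : Set (MvPolynomial ι ℝ), Z = {x | ∀ p ∈ P, MvPolynomial.eval (φ x) p = 0}) :
    IsZariski φ := by
  refine ⟨TopologicalSpace.ext_iff_isClosed.2 fun Z => ?_⟩
  have h' : @IsZariski X ι (TopologicalSpace.induced (evalSpec φ) inferInstance) φ :=
    letI := TopologicalSpace.induced (evalSpec φ) inferInstance
    ⟨rfl⟩
  rw [h, @IsZariski.isClosed_iff X ι (TopologicalSpace.induced (evalSpec φ) inferInstance) φ h']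

/-- An inducing map bounds the dimension of its source by that of its target, here the spectrum of a
polynomial ring in finitely many variables. This is the reason for expressing the topology through
prime spectra. -/
theorem IsZariski.topologicalKrullDim_lt_top [TopologicalSpace X] [Finite ι] {φ : X → ι → ℝ}
    (h : IsZariski φ) : topologicalKrullDim X < ⊤ := by
  refine (IsInducing.topologicalKrullDim_le h).trans_lt ?_
  rw [PrimeSpectrum.topologicalKrullDim_eq_ringKrullDim,
    MvPolynomial.ringKrullDim_of_isNoetherianRing, ringKrullDim_eq_zero_of_field, zero_add]
  exact WithBot.coe_lt_coe.2 (WithTop.coe_lt_top _)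

/-- The algebra of polynomial functions in the coordinates `φ`. -/
def regular (φ : X → ι → ℝ) : Subalgebra ℝ (X → ℝ) :=
  (MvPolynomial.aeval fun i x => φ x i : MvPolynomial ι ℝ →ₐ[ℝ] X → ℝ).range

theorem aeval_coord_apply (φ : X → ι → ℝ) (p : MvPolynomial ι ℝ) (x : X) :
    (MvPolynomial.aeval fun i x => φ x i : MvPolynomial ι ℝ →ₐ[ℝ] X → ℝ) p x =
      MvPolynomial.eval (φ x) p := by
  induction p using MvPolynomial.induction_on with
  | C a => simp
  | add p q hp hq => simp [hp, hq]
  | mul_X p i hp => simp [hp]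

theorem mem_regular {φ : X → ι → ℝ} {f : X → ℝ} :
    f ∈ regular φ ↔ ∃ p, ∀ x, f x = MvPolynomial.eval (φ x) p := by
  constructor
  · rintro ⟨p, rfl⟩
    exact ⟨p, aeval_coord_apply φ p⟩
  · rintro ⟨p, hp⟩
    exact ⟨p, funext fun x => (aeval_coord_apply φ p x).trans (hp x).symm⟩

theorem coord_mem_regular (φ : X → ι → ℝ) (i : ι) : (fun x => φ x i) ∈ regular φ :=
  mem_regular.2 ⟨MvPolynomial.X i, fun x => by simp⟩

theorem eval_mem_regular {φ : X → ι → ℝ} {ψ : X → κ → ℝ}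
    (h : ∀ k, (fun x => ψ x k) ∈ regular φ) (p : MvPolynomial κ ℝ) :
    (fun x => MvPolynomial.eval (ψ x) p) ∈ regular φ := by
  induction p using MvPolynomial.induction_on with
  | C a =>
    simp only [MvPolynomial.eval_C]
    exact (regular φ).algebraMap_mem a
  | add p q hp hq =>
    simp only [map_add]
    exact (regular φ).add_mem hp hq
  | mul_X p i hp =>
    simp only [map_mul, MvPolynomial.eval_X]
    exact (regular φ).mul_mem hp (h i)

theorem IsZariski.isClosed_zero [TopologicalSpace X] {φ : X → ι → ℝ} (h : IsZariski φ)
    {f : X → ℝ} (hf : f ∈ regular φ) : IsClosed {x | f x = 0} := by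
  obtain ⟨p, hp⟩ := mem_regular.1 hf
  exact h.isClosed_iff.2 ⟨{p}, by simp [hp]⟩

theorem IsZariski.continuous [TopologicalSpace X] [TopologicalSpace Y] {φ : X → ι → ℝ}
    {ψ : Y → κ → ℝ} (hφ : IsZariski φ) (hψ : IsZariski ψ) {f : X → Y}
    (h : ∀ k, (fun x => ψ (f x) k) ∈ regular φ) : Continuous f := by
  refine continuous_iff_isClosed.2 fun Z hZ => ?_
  obtain ⟨P, rfl⟩ := hψ.isClosed_iff.1 hZ
  have : f ⁻¹' {x | ∀ p ∈ P, MvPolynomial.eval (ψ x) p = 0} =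
      ⋂ p ∈ P, {x | MvPolynomial.eval (ψ (f x)) p = 0} := by ext; simp
  rw [this]
  exact isClosed_biInter fun p _ => hφ.isClosed_zero (eval_mem_regular h p)

/-- The two hypotheses say that the coordinates `φ` and the pulled-back coordinates `ψ ∘ f` generate
the same algebra of functions, so they have the same zero sets. -/
theorem IsZariski.isInducing [TopologicalSpace X] [TopologicalSpace Y] {φ : X → ι → ℝ}
    {ψ : Y → κ → ℝ} (hφ : IsZariski φ) (hψ : IsZariski ψ) {f : X → Y}
    (h : ∀ k, (fun x => ψ (f x) k) ∈ regular φ)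
    (h' : ∀ i, (fun x => φ x i) ∈ regular fun x => ψ (f x)) : IsInducing f := by
  refine ⟨TopologicalSpace.ext_iff_isClosed.2 fun Z => ?_⟩
  rw [isClosed_induced_iff]
  constructor
  · intro hZ
    obtain ⟨P, rfl⟩ := hφ.isClosed_iff.1 hZ
    choose q hq using fun p : MvPolynomial ι ℝ => mem_regular.1 (eval_mem_regular h' p)
    refine ⟨{y | ∀ p ∈ q '' P, MvPolynomial.eval (ψ y) p = 0}, hψ.isClosed_iff.2 ⟨_, rfl⟩, ?_⟩
    ext x
    simp [hq]
  · rintro ⟨T, hT, rfl⟩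
    exact hT.preimage (hφ.continuous hψ h)

/-- Points of `X` joined by curves with real analytic coordinates form an irreducible space. -/
theorem IsZariski.preirreducibleSpace [TopologicalSpace X] {φ : X → ι → ℝ} (h : IsZariski φ)
    (hc : ∀ x y : X, ∃ γ : ℝ → X, γ 0 = x ∧ γ 1 = y ∧
      ∀ i, AnalyticOnNhd ℝ (fun t => φ (γ t) i) Set.univ) : PreirreducibleSpace X := by
  have key : ∀ U : Set X, IsOpen U → ∀ x ∈ U, ∃ p : MvPolynomial ι ℝ,
      MvPolynomial.eval (φ x) p ≠ 0 ∧ ∀ y, MvPolynomial.eval (φ y) p ≠ 0 → y ∈ U := by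
    intro U hU x hx
    obtain ⟨P, hP⟩ := h.isClosed_iff.1 hU.isClosed_compl
    have hx' : x ∉ Uᶜ := fun h => h hx
    rw [hP] at hx'
    simp only [Set.mem_ofPred_eq, not_forall] at hx'
    obtain ⟨p, hp, hpx⟩ := hx'
    refine ⟨p, hpx, fun y hy => ?_⟩
    by_contra hyU
    have : y ∈ Uᶜ := hyU
    rw [hP] at this
    exact hy (this p hp)
  refine ⟨fun U V hU hV ⟨x, _, hx⟩ ⟨y, _, hy⟩ => ?_⟩
  obtain ⟨p, hpx, hp⟩ := key U hU x hx
  obtain ⟨q, hqy, hq⟩ := key V hV y hy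
  obtain ⟨γ, rfl, rfl, hγ⟩ := hc x y
  by_contra H
  have ha : ∀ r : MvPolynomial ι ℝ,
      AnalyticOnNhd ℝ (fun t => MvPolynomial.eval (φ (γ t)) r) Set.univ := by
    intro r
    simpa [MvPolynomial.aeval_eq_eval] using AnalyticOnNhd.aeval_mvPolynomial hγ r
  -- If the open sets were disjoint, the product of the two polynomials would vanish along the whole
  -- curve; analytic functions on a connected line have no zero divisors.
  have := (ha p).eq_zero_or_eq_zero_of_mul_eq_zero (ha q) (fun t _ => by
    by_contra h0
    obtain ⟨h1, h2⟩ := mul_ne_zero_iff.1 h0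
    exact H ⟨γ t, trivial, hp _ h1, hq _ h2⟩) isPreconnected_univ
  rcases this with h0 | h0
  · exact hpx (h0 0 trivial)
  · exact hqy (h0 1 trivial)

/-- The real coordinates given by real and imaginary parts of complex coordinates. -/
def reIm (F : X → J → ℂ) (x : X) : J ⊕ J → ℝ :=
  Sum.elim (fun j => (F x j).re) fun j => (F x j).im

/-- Complex functions whose real and imaginary parts are polynomials in the coordinates `φ`. -/
def regularC (φ : X → ι → ℝ) : Subalgebra ℂ (X → ℂ) where
  carrier := {f | (fun x => (f x).re) ∈ regular φ ∧ (fun x => (f x).im) ∈ regular φ}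
  mul_mem' := by
    rintro f g ⟨h1, h2⟩ ⟨h3, h4⟩
    refine ⟨?_, ?_⟩
    · simp only [Pi.mul_apply, Complex.mul_re]
      exact (regular φ).sub_mem ((regular φ).mul_mem h1 h3) ((regular φ).mul_mem h2 h4)
    · simp only [Pi.mul_apply, Complex.mul_im]
      exact (regular φ).add_mem ((regular φ).mul_mem h1 h4) ((regular φ).mul_mem h2 h3)
  add_mem' := by
    rintro f g ⟨h1, h2⟩ ⟨h3, h4⟩
    exact ⟨(regular φ).add_mem h1 h3, (regular φ).add_mem h2 h4⟩
  algebraMap_mem' := fun z =>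
    ⟨(regular φ).algebraMap_mem z.re, (regular φ).algebraMap_mem z.im⟩

theorem const_mem_regularC (φ : X → ι → ℝ) (z : ℂ) : (fun _ => z) ∈ regularC φ :=
  (regularC φ).algebraMap_mem z

theorem conj_mem_regularC {φ : X → ι → ℝ} {f : X → ℂ} (hf : f ∈ regularC φ) :
    (fun x => (starRingEnd ℂ) (f x)) ∈ regularC φ :=
  ⟨hf.1, (regular φ).neg_mem hf.2⟩

theorem coord_mem_regularC (F : X → J → ℂ) (j : J) : (fun x => F x j) ∈ regularC (reIm F) :=
  ⟨coord_mem_regular (reIm F) (Sum.inl j), coord_mem_regular (reIm F) (Sum.inr j)⟩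

theorem IsZariski.isClosed_eq [TopologicalSpace X] {φ : X → ι → ℝ} (h : IsZariski φ)
    {f g : X → ℂ} (hf : f ∈ regularC φ) (hg : g ∈ regularC φ) : IsClosed {x | f x = g x} := by
  have hfg := (regularC φ).sub_mem hf hg
  have : {x | f x = g x} = {x | ((f - g) x).re = 0} ∩ {x | ((f - g) x).im = 0} := by
    ext x
    simp [Complex.ext_iff, sub_eq_zero]
  rw [this]
  exact (h.isClosed_zero hfg.1).inter (h.isClosed_zero hfg.2)

theorem reIm_mem_regular {φ : X → ι → ℝ} {F : X → J → ℂ}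
    (h : ∀ j, (fun x => F x j) ∈ regularC φ) (j : J ⊕ J) : (fun x => reIm F x j) ∈ regular φ := by
  rcases j with j | j
  · exact (h j).1
  · exact (h j).2

end Zariski

/-! ### Krull dimension of irreducible spaces -/

/-- A proper closed subset of an irreducible space of finite dimension has smaller dimension. -/
theorem topologicalKrullDim_lt_of_isClosed {X : Type*} [TopologicalSpace X] [IrreducibleSpace X]
    (hX : topologicalKrullDim X < ⊤) {Z : Set X} (hZ : IsClosed Z) (hne : Z ≠ Set.univ) :
    topologicalKrullDim Z < topologicalKrullDim X := by
  -- The whole space can be added on top of any chain of irreducible closed subsets of `Z`, which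
  -- gives `dim Z + 1 ≤ dim X`.
  let f : WithTop (TopologicalSpace.IrreducibleCloseds Z) →
      TopologicalSpace.IrreducibleCloseds X := fun W =>
    WithTop.recTopCoe ⟨Set.univ, IrreducibleSpace.isIrreducible_univ X, isClosed_univ⟩
      (fun W => TopologicalSpace.IrreducibleCloseds.map Subtype.val continuous_subtype_val W) W
  have hsub : ∀ W : TopologicalSpace.IrreducibleCloseds Z,
      ((TopologicalSpace.IrreducibleCloseds.map Subtype.val continuous_subtype_val W :
        TopologicalSpace.IrreducibleCloseds X) : Set X) ⊆ Z := by
    intro W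
    refine closure_minimal ?_ hZ
    rintro _ ⟨x, _, rfl⟩
    exact x.2
  have hf : StrictMono f := by
    intro A B hAB
    induction B using WithTop.recTopCoe with
    | top =>
      induction A using WithTop.recTopCoe with
      | top => exact absurd hAB (lt_irrefl _)
      | coe A =>
        refine lt_of_le_of_ne (fun x _ => trivial) fun h => hne ?_
        refine Set.eq_univ_of_univ_subset fun x _ => ?_
        have h2 := hsub A
        have h3 : TopologicalSpace.IrreducibleCloseds.map Subtype.val continuous_subtype_val A =
          (⟨Set.univ, IrreducibleSpace.isIrreducible_univ X, isClosed_univ⟩ :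
            TopologicalSpace.IrreducibleCloseds X) := h
        rw [h3] at h2
        exact h2 trivial
    | coe B =>
      induction A using WithTop.recTopCoe with
      | top => exact absurd hAB (not_lt_of_ge le_top)
      | coe A =>
        exact TopologicalSpace.IrreducibleCloseds.map_strictMono_of_isInducing
          IsInducing.subtypeVal (WithTop.coe_lt_coe.1 hAB)
  have h1 := Order.krullDim_le_of_strictMono f hf
  rcases Set.eq_empty_or_nonempty Z with rfl | ⟨x, hx⟩
  · have : IsEmpty (TopologicalSpace.IrreducibleCloseds (∅ : Set X)) :=
      ⟨fun W => by obtain ⟨y, _⟩ := W.isIrreducible.nonempty; exact y.2⟩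
    have h0 : topologicalKrullDim (∅ : Set X) = ⊥ := Order.krullDim_eq_bot
    rw [h0]
    have : Nonempty (TopologicalSpace.IrreducibleCloseds X) := ⟨f ⊤⟩
    exact Order.bot_lt_krullDim
  · have : Nonempty (TopologicalSpace.IrreducibleCloseds Z) :=
      ⟨⟨closure {⟨x, hx⟩}, isIrreducible_singleton.closure, isClosed_closure⟩⟩
    rw [Order.krullDim_WithTop] at h1
    change topologicalKrullDim Z + 1 ≤ topologicalKrullDim X at h1
    have hb : topologicalKrullDim Z ≠ ⊥ := Order.krullDim_ne_bot_iff.2 inferInstance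
    -- Finiteness of `dim X` is essential here: `a + 1 ≤ b` gives `a < b` only when `a ≠ ⊤`.
    revert h1 hX hb
    generalize topologicalKrullDim Z = a
    generalize topologicalKrullDim X = b
    intro hb h1 ha
    induction a with
    | bot => exact absurd rfl ha
    | coe a =>
      induction b with
      | bot => exact absurd h1 (by rw [← WithBot.coe_one, ← WithBot.coe_add]; simp)
      | coe b =>
        have h2 : a + 1 ≤ b := by exact_mod_cast h1
        have h3 : b < ⊤ := by exact WithBot.coe_lt_coe.1 hb
        refine WithBot.coe_lt_coe.2 (lt_of_lt_of_le ?_ h2)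
        have h4 : a ≠ ⊤ := by
          rintro rfl
          exact absurd (lt_of_le_of_lt h2 h3) (by simp)
        exact ENat.lt_add_one_iff h4 |>.2 le_rfl

/-- Nested irreducible closed sets of the same finite dimension are equal. -/
theorem eq_of_subset_of_topologicalKrullDim_le {X : Type*} [TopologicalSpace X] {Z Y : Set X}
    (hX : topologicalKrullDim X < ⊤) (hZ : IsClosed Z) (hY : IsIrreducible Y)
    (h : Z ⊆ Y) (hd : topologicalKrullDim Y ≤ topologicalKrullDim Z) : Z = Y := by
  by_contra hne
  have : IrreducibleSpace Y := isIrreducible_iff_irreducibleSpace.1 hY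
  have h1 : topologicalKrullDim (Subtype.val ⁻¹' Z : Set Y) < topologicalKrullDim Y :=
    topologicalKrullDim_lt_of_isClosed ((topologicalKrullDim_subspace_le X Y).trans_lt hX)
      (hZ.preimage continuous_subtype_val) fun h0 => hne (h.antisymm fun y hy => by
        have : (⟨y, hy⟩ : Y) ∈ (Subtype.val ⁻¹' Z : Set Y) := by rw [h0]; trivial
        exact this)
  have h2 : IsInducing (fun z : Z => (⟨⟨z.1, h z.2⟩, z.2⟩ : (Subtype.val ⁻¹' Z : Set Y))) := by
    refine IsInducing.of_comp (g := fun y => (y.1.1 : X)) ?_ ?_ ?_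
    · fun_prop
    · fun_prop
    · exact IsInducing.subtypeVal
  exact absurd (hd.trans h2.topologicalKrullDim_le) (not_le_of_gt h1)

end Qubits

end

noncomputable section

namespace Qubits

open scoped LinearAlgebra.Projectivization
open Topology

/-! ### Entries of the orthogonal projection onto a line -/

section Line

variable {ι : Type*} [Fintype ι]

/-- An entry of the matrix of the orthogonal projection onto a line. -/
def lineEntry (p : ℙ ℂ (EuclideanSpace ℂ ι)) (a b : ι) : ℂ :=
  p.rep a * (starRingEnd ℂ) (p.rep b) / ((‖p.rep‖ ^ 2 : ℝ) : ℂ)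

theorem lineEntry_mk (v : EuclideanSpace ℂ ι) (hv : v ≠ 0) (a b : ι) :
    lineEntry (Projectivization.mk ℂ v hv) a b =
      v a * (starRingEnd ℂ) (v b) / ((‖v‖ ^ 2 : ℝ) : ℂ) := by
  obtain ⟨c, hc⟩ := Projectivization.exists_smul_eq_mk_rep ℂ v hv
  have hc0 : (c : ℂ) ≠ 0 := c.ne_zero
  have hv0 : ((‖v‖ : ℝ) : ℂ) ≠ 0 := by exact_mod_cast norm_ne_zero_iff.2 hv
  have hcn : ((‖(c : ℂ)‖ : ℝ) : ℂ) ≠ 0 := by exact_mod_cast norm_ne_zero_iff.2 hc0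
  have h1 : (c : ℂ) * (starRingEnd ℂ) (c : ℂ) = ((‖(c : ℂ)‖ ^ 2 : ℝ) : ℂ) := by
    rw [Complex.mul_conj, Complex.normSq_eq_norm_sq]
  unfold lineEntry
  rw [← hc, Units.smul_def, norm_smul, PiLp.smul_apply, PiLp.smul_apply, smul_eq_mul, smul_eq_mul,
    map_mul, mul_mul_mul_comm, h1, mul_pow, Complex.ofReal_mul]
  push_cast
  field_simp

theorem lineEntry_self_eq_zero {p : ℙ ℂ (EuclideanSpace ℂ ι)} {a : ι} :
    lineEntry p a a = 0 ↔ p.rep a = 0 := by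
  have : ((‖p.rep‖ ^ 2 : ℝ) : ℂ) ≠ 0 := by
    exact_mod_cast pow_ne_zero 2 (norm_ne_zero_iff.2 p.rep_nonzero)
  simp [lineEntry, p.rep_nonzero]

theorem eq_of_lineEntry_eq {p q : ℙ ℂ (EuclideanSpace ℂ ι)}
    (h : ∀ a b, lineEntry p a b = lineEntry q a b) : p = q := by
  obtain ⟨b, hb⟩ := exists_coord_ne_zero p.rep_nonzero
  have hb' : q.rep b ≠ 0 := fun h0 => hb (lineEntry_self_eq_zero.1
    ((h b b).trans (lineEntry_self_eq_zero.2 h0)))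
  have hp : ((‖p.rep‖ ^ 2 : ℝ) : ℂ) ≠ 0 := by
    exact_mod_cast pow_ne_zero 2 (norm_ne_zero_iff.2 p.rep_nonzero)
  have hq : ((‖q.rep‖ ^ 2 : ℝ) : ℂ) ≠ 0 := by
    exact_mod_cast pow_ne_zero 2 (norm_ne_zero_iff.2 q.rep_nonzero)
  have hcb : (starRingEnd ℂ) (p.rep b) ≠ 0 := by simpa using hb
  rw [← p.mk_rep, ← q.mk_rep, Projectivization.mk_eq_mk_iff']
  -- Column `b` of the projection matrix spans the line; the scalar comes from equating the two
  -- columns.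
  refine ⟨(starRingEnd ℂ) (q.rep b) / ((‖q.rep‖ ^ 2 : ℝ) : ℂ) *
    (((‖p.rep‖ ^ 2 : ℝ) : ℂ) / (starRingEnd ℂ) (p.rep b)), ?_⟩
  ext a
  have := h a b
  unfold lineEntry at this
  rw [PiLp.smul_apply, smul_eq_mul]
  field_simp at this ⊢
  linear_combination -this

theorem sum_lineEntry (p : ℙ ℂ (EuclideanSpace ℂ ι)) : ∑ a, lineEntry p a a = 1 := by
  have hp : ((‖p.rep‖ ^ 2 : ℝ) : ℂ) ≠ 0 := by
    exact_mod_cast pow_ne_zero 2 (norm_ne_zero_iff.2 p.rep_nonzero)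
  unfold lineEntry
  rw [← Finset.sum_div, div_eq_one_iff_eq hp, EuclideanSpace.norm_sq_eq]
  push_cast
  refine Finset.sum_congr rfl fun a _ => ?_
  rw [Complex.mul_conj, Complex.normSq_eq_norm_sq]
  push_cast
  rfl

theorem conj_lineEntry (p : ℙ ℂ (EuclideanSpace ℂ ι)) (a b : ι) :
    (starRingEnd ℂ) (lineEntry p a b) = lineEntry p b a := by
  simp [lineEntry, mul_comm]

theorem lineEntry_mul_lineEntry (p : ℙ ℂ (EuclideanSpace ℂ ι)) (a b c d : ι) :
    lineEntry p a b * lineEntry p c d = lineEntry p a d * lineEntry p c b := by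
  unfold lineEntry
  ring

end Line

/-! ### One qubit -/

/-- By Cayley–Hamilton, trace one and determinant zero make the matrix idempotent, so being
Hermitian it is a rank-one projection and any nonzero column spans its line. These polynomial
conditions later cut out the pieces as closed sets. -/
theorem exists_lineEntry_eq {M : Fin 2 → Fin 2 → ℂ} (htr : M 0 0 + M 1 1 = 1)
    (hs : ∀ a b, (starRingEnd ℂ) (M a b) = M b a) (hdet : M 0 0 * M 1 1 = M 0 1 * M 1 0) :
    ∃ p : ℙ ℂ Qubit, ∀ a b, lineEntry p a b = M a b := by
  obtain ⟨b, hb⟩ : ∃ b, M b b ≠ 0 := by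
    by_contra! H
    simp [H] at htr
  have hv : (WithLp.toLp 2 fun a => M a b : Qubit) ≠ 0 := fun h0 =>
    hb (by simpa using congrArg (fun v : Qubit => v b) h0)
  -- The squared norm of column `b` is the diagonal entry of `M ^ 2 = M`.
  have hn : ((‖(WithLp.toLp 2 fun a => M a b : Qubit)‖ ^ 2 : ℝ) : ℂ) = M b b := by
    rw [EuclideanSpace.norm_sq_eq]
    push_cast
    have : ∀ a, ((‖M a b‖ : ℝ) : ℂ) ^ 2 = M a b * M b a := by
      intro a
      rw [← hs a b, Complex.mul_conj, Complex.normSq_eq_norm_sq]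
      push_cast
      rfl
    simp only [this, Fin.sum_univ_two]
    fin_cases b
    · simp only [Fin.zero_eta]
      linear_combination M 0 0 * htr - hdet
    · simp only [Fin.mk_one]
      linear_combination M 1 1 * htr - hdet
  refine ⟨Projectivization.mk ℂ _ hv, fun a c => ?_⟩
  rw [lineEntry_mk, hn, div_eq_iff hb]
  simp only [hs]
  fin_cases b <;> fin_cases a <;> fin_cases c <;> simp only [Fin.zero_eta, Fin.mk_one] <;>
    first | ring1 | linear_combination hdet | linear_combination -hdet

theorem lineEntry_hat (p : ℙ ℂ Qubit) (a b : Fin 2) :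
    lineEntry (hat p) a b = (if a = b then 1 else 0) - lineEntry p a b := by
  have hn : ‖perp p.rep‖ ^ 2 = ‖p.rep‖ ^ 2 := by
    simp [EuclideanSpace.norm_sq_eq, perp, add_comm]
  have hp : ((‖p.rep‖ ^ 2 : ℝ) : ℂ) ≠ 0 := by
    exact_mod_cast pow_ne_zero 2 (norm_ne_zero_iff.2 p.rep_nonzero)
  have htr := sum_lineEntry p
  rw [Fin.sum_univ_two] at htr
  unfold hat
  rw [lineEntry_mk, hn]
  unfold lineEntry at htr ⊢
  fin_cases a <;> fin_cases b <;> simp [perp] <;>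
    simp only [Complex.ofReal_pow] at htr ⊢
  · linear_combination htr
  · ring
  · ring
  · linear_combination htr

theorem hat_hat (p : ℙ ℂ Qubit) : hat (hat p) = p :=
  eq_of_lineEntry_eq fun a b => by simp [lineEntry_hat]

theorem inner_rep_eq_zero_iff (p q : ℙ ℂ Qubit) : inner ℂ p.rep q.rep = 0 ↔ q = hat p := by
  have hin : ∀ v w : Qubit, inner ℂ v w =
      (starRingEnd ℂ) (v 0) * w 0 + (starRingEnd ℂ) (v 1) * w 1 := by
    intro v w
    simp [PiLp.inner_apply, Fin.sum_univ_two, mul_comm]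
  constructor
  · intro h
    rw [hin] at h
    rw [← q.mk_rep, hat, Projectivization.mk_eq_mk_iff']
    obtain ⟨i, hi⟩ := exists_coord_ne_zero p.rep_nonzero
    fin_cases i
    · have h0 : (starRingEnd ℂ) (p.rep 0) ≠ 0 := by simpa using hi
      refine ⟨q.rep 1 / (starRingEnd ℂ) (p.rep 0), ?_⟩
      ext a
      fin_cases a
      · simp [perp]
        field_simp
        linear_combination -h
      · simp [perp]
        field_simp
    · have h0 : (starRingEnd ℂ) (p.rep 1) ≠ 0 := by simpa using hi
      refine ⟨-q.rep 0 / (starRingEnd ℂ) (p.rep 1), ?_⟩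
      ext a
      fin_cases a
      · simp [perp]
        field_simp
      · simp [perp]
        field_simp
        linear_combination -h
  · rintro rfl
    obtain ⟨c, hc⟩ := Projectivization.exists_smul_eq_mk_rep ℂ (perp p.rep)
      (perp_ne_zero p.rep_nonzero)
    have : (hat p).rep = (c : ℂ) • perp p.rep := hc.symm
    rw [this, hin]
    simp [perp]
    ring

theorem hat_ne (p : ℙ ℂ Qubit) : hat p ≠ p := fun h =>
  p.rep_nonzero (inner_self_eq_zero.1 ((inner_rep_eq_zero_iff p p).2 h.symm))

/-- The segment joining representatives of two different lines avoids zero, so the entries along it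
are quotients of real analytic functions with nonvanishing denominator. -/
theorem exists_analytic_curve (p q : ℙ ℂ Qubit) : ∃ γ : ℝ → ℙ ℂ Qubit, γ 0 = p ∧ γ 1 = q ∧
    ∀ a b, AnalyticOnNhd ℝ (fun t => lineEntry (γ t) a b) Set.univ := by
  rcases eq_or_ne p q with rfl | hpq
  · exact ⟨fun _ => p, rfl, rfl, fun a b => analyticOnNhd_const⟩
  have hv : ∀ t : ℝ, ((1 - t : ℝ) : ℂ) • p.rep + (t : ℂ) • q.rep ≠ 0 := by
    intro t h
    rcases eq_or_ne t 0 with rfl | ht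
    · exact p.rep_nonzero (by simpa using h)
    · have ht' : (t : ℂ) ≠ 0 := by exact_mod_cast ht
      refine hpq.symm ?_
      rw [← p.mk_rep, ← q.mk_rep, Projectivization.mk_eq_mk_iff']
      refine ⟨-((1 - t : ℝ) : ℂ) / (t : ℂ), ?_⟩
      rw [div_eq_inv_mul, mul_smul, neg_smul, neg_eq_of_add_eq_zero_right h, smul_smul,
        inv_mul_cancel₀ ht', one_smul]
  refine ⟨fun t => Projectivization.mk ℂ _ (hv t), ?_, ?_, fun a b t _ => ?_⟩
  · simp
  · simp
  · have hof : ∀ s, AnalyticAt ℝ (fun t : ℝ => (t : ℂ)) s := fun s =>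
      Complex.ofRealCLM.analyticAt s
    have hc : ∀ a, AnalyticAt ℝ
        (fun t : ℝ => (((1 - t : ℝ) : ℂ) • p.rep + (t : ℂ) • q.rep : Qubit) a) t := by
      intro a
      simp only [PiLp.add_apply, PiLp.smul_apply, smul_eq_mul, Complex.ofReal_sub,
        Complex.ofReal_one]
      exact ((analyticAt_const.sub (hof t)).mul analyticAt_const).add
        ((hof t).mul analyticAt_const)
    have hcc : ∀ a, AnalyticAt ℝ (fun t : ℝ =>
        (starRingEnd ℂ) ((((1 - t : ℝ) : ℂ) • p.rep + (t : ℂ) • q.rep : Qubit) a)) t := fun a =>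
      (Complex.conjCLE.toContinuousLinearMap.analyticAt _).comp (hc a)
    have hn : ∀ v : Qubit, ((‖v‖ ^ 2 : ℝ) : ℂ) = ∑ a, v a * (starRingEnd ℂ) (v a) := by
      intro v
      rw [EuclideanSpace.norm_sq_eq]
      push_cast
      refine Finset.sum_congr rfl fun a _ => ?_
      rw [Complex.mul_conj, Complex.normSq_eq_norm_sq]
      push_cast
      rfl
    simp only [lineEntry_mk]
    refine ((hc a).mul (hcc b)).div ?_ ?_
    · simp only [hn, Fin.sum_univ_two]
      exact ((hc 0).mul (hcc 0)).add ((hc 1).mul (hcc 1))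
    · exact Complex.ofReal_ne_zero.2 (pow_ne_zero 2 (norm_ne_zero_iff.2 (hv t)))

/-! ### Families of qubit states -/

/-- Families of qubit states indexed by `κ`, with the real Zariski topology. -/
def Config (κ : Type*) : Type _ := κ → ℙ ℂ Qubit

/-- The complex coordinates on families of qubit states. -/
def Config.entry {κ : Type*} (u : Config κ) (j : κ × Fin 2 × Fin 2) : ℂ :=
  lineEntry (u j.1) j.2.1 j.2.2

instance (κ : Type*) : TopologicalSpace (Config κ) :=
  TopologicalSpace.induced (evalSpec (reIm Config.entry)) inferInstance

theorem Config.isZariski (κ : Type*) : IsZariski (reIm (Config.entry (κ := κ))) := ⟨rfl⟩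

instance (κ : Type*) : Nonempty (Config κ) :=
  ⟨fun _ => Projectivization.mk ℂ (EuclideanSpace.single 0 1) (by simp)⟩

instance (κ : Type*) : IrreducibleSpace (Config κ) where
  toPreirreducibleSpace := by
    refine (Config.isZariski κ).preirreducibleSpace fun u v => ?_
    choose γ h0 h1 hγ using fun k => exists_analytic_curve (u k) (v k)
    refine ⟨fun t k => γ k t, funext h0, funext h1, ?_⟩
    rintro (j | j) t ht
    · exact (Complex.reCLM.analyticAt _).comp (hγ j.1 j.2.1 j.2.2 t ht)
    · exact (Complex.imCLM.analyticAt _).comp (hγ j.1 j.2.1 j.2.2 t ht)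
  toNonempty := inferInstance

theorem Config.topologicalKrullDim_lt_top (κ : Type*) [Finite κ] :
    topologicalKrullDim (Config κ) < ⊤ :=
  (Config.isZariski κ).topologicalKrullDim_lt_top

theorem Config.lineEntry_mem_regularC {κ : Type*} (k : κ) (a b : Fin 2) :
    (fun u : Config κ => lineEntry (u k) a b) ∈ regularC (reIm Config.entry) :=
  coord_mem_regularC Config.entry (k, a, b)

/-- Extend a family of qubit states by a constant. -/
def Config.extend {κ κ' : Type*} (f : κ → κ') (p : ℙ ℂ Qubit) (u : Config κ) : Config κ' :=
  Function.extend f u fun _ => p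

theorem Config.extend_apply {κ κ' : Type*} {f : κ → κ'} (hf : Function.Injective f)
    (p : ℙ ℂ Qubit) (u : Config κ) (k : κ) : Config.extend f p u (f k) = u k :=
  hf.extend_apply _ _ _

theorem Config.extend_apply' {κ κ' : Type*} {f : κ → κ'} {k : κ'} (hk : ¬∃ l, f l = k)
    (p : ℙ ℂ Qubit) (u : Config κ) : Config.extend f p u k = p :=
  Function.extend_apply' _ _ _ hk

theorem Config.isInducing_extend {κ κ' : Type*} {f : κ → κ'} (hf : Function.Injective f)
    (p : ℙ ℂ Qubit) : IsInducing (Config.extend f p) := by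
  refine (Config.isZariski κ).isInducing (Config.isZariski κ') (reIm_mem_regular ?_)
    (reIm_mem_regular ?_)
  · rintro ⟨k, a, b⟩
    by_cases hk : ∃ l, f l = k
    · obtain ⟨l, rfl⟩ := hk
      simpa only [Config.entry, Config.extend_apply hf] using
        Config.lineEntry_mem_regularC l a b
    · simpa only [Config.entry, Config.extend_apply' hk] using
        const_mem_regularC _ _
  · rintro ⟨k, a, b⟩
    have := coord_mem_regularC (fun u : Config κ => (Config.extend f p u).entry) (f k, a, b)
    simp only [Config.entry, Config.extend_apply hf] at this
    exact this

theorem Config.topologicalKrullDim_le {κ κ' : Type*} [Fintype κ] [Fintype κ']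
    (h : Fintype.card κ ≤ Fintype.card κ') :
    topologicalKrullDim (Config κ) ≤ topologicalKrullDim (Config κ') := by
  obtain ⟨f⟩ := Function.Embedding.nonempty_of_card_le h
  obtain ⟨u⟩ : Nonempty (Config Unit) := inferInstance
  exact (Config.isInducing_extend f.injective (u ())).topologicalKrullDim_le

/-- The smaller family embeds into the larger one with some coordinate frozen at `p`. This locus is
closed and proper in an irreducible space of finite dimension, so the dimension drops. -/
theorem Config.topologicalKrullDim_lt {κ κ' : Type*} [Fintype κ] [Fintype κ']
    (h : Fintype.card κ < Fintype.card κ') :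
    topologicalKrullDim (Config κ) < topologicalKrullDim (Config κ') := by
  obtain ⟨f⟩ := Function.Embedding.nonempty_of_card_le h.le
  obtain ⟨k, hk⟩ : ∃ k, ∀ l, f l ≠ k := by
    by_contra! H
    exact absurd (Fintype.card_le_of_surjective f H) (not_le_of_gt h)
  obtain ⟨u⟩ : Nonempty (Config Unit) := inferInstance
  set p := u ()
  let Z : Set (Config κ') := {w | w k = p}
  have hZ : IsClosed Z := by
    have : Z = ⋂ a, ⋂ b, {w : Config κ' | lineEntry (w k) a b = lineEntry p a b} := by
      ext w
      simp only [Set.mem_iInter, Set.mem_ofPred_eq, Z]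
      exact ⟨fun h a b => by rw [h], eq_of_lineEntry_eq⟩
    rw [this]
    exact isClosed_iInter fun a => isClosed_iInter fun b => (Config.isZariski κ').isClosed_eq
      (Config.lineEntry_mem_regularC k a b) (const_mem_regularC _ _)
  have hne : Z ≠ Set.univ := fun h0 => by
    have : (fun _ => hat p : Config κ') ∈ Z := by rw [h0]; trivial
    exact hat_ne p this
  refine lt_of_le_of_lt ?_ (topologicalKrullDim_lt_of_isClosed
    (Config.topologicalKrullDim_lt_top κ') hZ hne)
  have hmem : ∀ w : Config κ, Config.extend f p w ∈ Z := fun w =>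
    Config.extend_apply' (fun ⟨l, hl⟩ => hk l hl) p w
  have h1 := Config.isInducing_extend f.injective p
  have h2 : IsInducing fun w : Config κ => (⟨_, hmem w⟩ : Z) :=
    IsInducing.of_comp (g := Subtype.val) (h1.continuous.subtype_mk _) continuous_subtype_val h1
  exact h2.topologicalKrullDim_le

end Qubits

end

noncomputable section

namespace Qubits

open scoped LinearAlgebra.Projectivization
open Topology

/-! ### Entries of product states -/

theorem sum_mem_regularC {X ι A : Type*} {φ : X → ι → ℝ} {S : Finset A} {f : A → X → ℂ}
    (h : ∀ a ∈ S, f a ∈ regularC φ) : (fun x => ∑ a ∈ S, f a x) ∈ regularC φ := by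
  have : (fun x => ∑ a ∈ S, f a x) = ∑ a ∈ S, f a := by ext x; simp
  rw [this]
  exact sum_mem h

theorem prod_mem_regularC {X ι A : Type*} {φ : X → ι → ℝ} {S : Finset A} {f : A → X → ℂ}
    (h : ∀ a ∈ S, f a ∈ regularC φ) : (fun x => ∏ a ∈ S, f a x) ∈ regularC φ := by
  have : (fun x => ∏ a ∈ S, f a x) = ∏ a ∈ S, f a := by ext x; simp
  rw [this]
  exact prod_mem h

theorem projEntry_eq_lineEntry {n : ℕ} (p : ℙ ℂ (Space n)) (a b : Vertex n) :
    projEntry p a b = lineEntry p a b := rfl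

/-- The complex coordinates of a tuple of lines. -/
def tupleEntry {n : ℕ} (u : Tuples n) (j : Vertex n × Vertex n × Vertex n) : ℂ :=
  projEntry (u j.1) j.2.1 j.2.2

theorem Tuples.isZariski (n : ℕ) : IsZariski (reIm (tupleEntry (n := n))) := by
  refine isZariski_of_isClosed_iff fun Z => ?_
  rw [← isOpen_compl_iff]
  change Zᶜᶜ ∈ {Z : Set (Tuples n) | ∃ P, Z = zeroSet P} ↔ _
  rw [compl_compl]
  rfl

theorem norm_sq_pureTensor {n : ℕ} (v : Fin n → Qubit) :
    ‖pureTensor v‖ ^ 2 = ∏ i, ‖v i‖ ^ 2 := by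
  simp only [EuclideanSpace.norm_sq_eq, Finset.prod_univ_sum, Fintype.piFinset_univ, pureTensor,
    norm_prod, Finset.prod_pow]

theorem projEntry_productState {n : ℕ} (x : Fin n → ℙ ℂ Qubit) (a b : Vertex n) :
    projEntry (productState x) a b = ∏ i, lineEntry (x i) (a i) (b i) := by
  rw [projEntry_eq_lineEntry, productState, lineEntry_mk, norm_sq_pureTensor]
  simp only [lineEntry, Finset.prod_div_distrib, Finset.prod_mul_distrib, pureTensor, map_prod,
    Complex.ofReal_prod]

/-- An entry of the reduced state of the `i`-th qubit. -/
def reducedEntry {n : ℕ} (p : ℙ ℂ (Space n)) (i : Fin n) (a b : Fin 2) : ℂ :=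
  ∑ s : Vertex n, if s i = 0 then projEntry p (Function.update s i a) (Function.update s i b) else 0

/-- Tracing out the other qubits contributes a factor one for each of them. Since the reduced state
is linear in the projection entries, every factor of a product state is a polynomial function of its
coordinates. -/
theorem reducedEntry_productState {n : ℕ} (x : Fin n → ℙ ℂ Qubit) (i : Fin n) (a b : Fin 2) :
    reducedEntry (productState x) i a b = lineEntry (x i) a b := by
  -- At position `i` only the bit `0` contributes, which matches the condition `s i = 0` that counts
  -- each assignment of the other coordinates once.
  let g : Fin n → Fin 2 → ℂ := fun j e =>
    if j = i then (if e = 0 then lineEntry (x i) a b else 0) else lineEntry (x j) e e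
  have h1 : ∏ j, ∑ e, g j e = lineEntry (x i) a b := by
    rw [Finset.prod_eq_single i]
    · simp [g]
    · intro j _ hj
      simp only [g, if_neg hj]
      exact sum_lineEntry _
    · simp
  rw [← h1, Finset.prod_univ_sum, Fintype.piFinset_univ, reducedEntry]
  refine Finset.sum_congr rfl fun s _ => ?_
  split_ifs with hs
  · rw [projEntry_productState]
    refine Finset.prod_congr rfl fun j _ => ?_
    rcases eq_or_ne j i with rfl | hj
    · simp [g, hs]
    · simp [g, hj]
  · refine (Finset.prod_eq_zero (Finset.mem_univ i) ?_).symm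
    simp [g, hs]

theorem projEntry_mem_regularC {n : ℕ} (s a b : Vertex n) :
    (fun w : Tuples n => projEntry (w s) a b) ∈ regularC (reIm tupleEntry) :=
  coord_mem_regularC tupleEntry (s, a, b)

theorem reducedEntry_mem_regularC {n : ℕ} (s : Vertex n) (i : Fin n) (a b : Fin 2) :
    (fun w : Tuples n => reducedEntry (w s) i a b) ∈ regularC (reIm tupleEntry) := by
  refine sum_mem_regularC fun t _ => ?_
  by_cases h : t i = 0
  · simpa only [h, if_true] using projEntry_mem_regularC _ _ _
  · simpa only [h, if_false] using const_mem_regularC _ _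

/-! ### Tuples of product states whose factors are prescribed by colors -/

/-- The entries of the projection `M` or of the complementary projection. -/
def orient (e : Fin 2) (M : Fin 2 → Fin 2 → ℂ) (a b : Fin 2) : ℂ :=
  if e = 0 then M a b else (if a = b then 1 else 0) - M a b

theorem orient_orient (e : Fin 2) (M : Fin 2 → Fin 2 → ℂ) : orient e (orient e M) = M := by
  ext a b
  unfold orient
  split_ifs <;> ring

theorem lineEntry_ite_hat (e : Fin 2) (p : ℙ ℂ Qubit) :
    lineEntry (if e = 0 then p else hat p) = orient e (lineEntry p) := by
  ext a b
  unfold orient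
  split_ifs <;> simp_all [lineEntry_hat]

theorem orient_mem_regularC {X ι : Type*} {φ : X → ι → ℝ} {M : X → Fin 2 → Fin 2 → ℂ}
    {e a b : Fin 2} (h : (fun x => M x a b) ∈ regularC φ) :
    (fun x => orient e (M x) a b) ∈ regularC φ := by
  unfold orient
  by_cases he : e = 0
  · simpa only [he, if_true] using h
  · simp only [he, if_false]
    exact (regularC φ).sub_mem (const_mem_regularC _ _) h

/-- The tuple of product states with `i`-th factor at `s` either `u (c s i)` or its orthogonal
complement, depending on `s i`. -/
def colorTuple {n : ℕ} {κ : Type*} (c : Vertex n → Fin n → κ) (u : Config κ) : Tuples n :=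
  fun s => productState fun i => if s i = 0 then u (c s i) else hat (u (c s i))

theorem projEntry_colorTuple {n : ℕ} {κ : Type*} (c : Vertex n → Fin n → κ) (u : Config κ)
    (s a b : Vertex n) :
    projEntry (colorTuple c u s) a b = ∏ i, orient (s i) (lineEntry (u (c s i))) (a i) (b i) := by
  rw [colorTuple, projEntry_productState]
  simp only [lineEntry_ite_hat]

theorem reducedEntry_colorTuple {n : ℕ} {κ : Type*} (c : Vertex n → Fin n → κ)
    (u : Config κ) (s : Vertex n) (i : Fin n) :
    orient (s i) (reducedEntry (colorTuple c u s) i) = lineEntry (u (c s i)) := by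
  have : reducedEntry (colorTuple c u s) i = orient (s i) (lineEntry (u (c s i))) := by
    ext a b
    rw [colorTuple, reducedEntry_productState]
    simp only [lineEntry_ite_hat]
  rw [this, orient_orient]

/-- Each color occurs somewhere, so its state can be read off polynomially from a reduced state
there. This left inverse makes the map injective and inducing, and supplies the equations of its
image. -/
theorem isClosedEmbedding_colorTuple {n : ℕ} {κ : Type*} (c : Vertex n → Fin n → κ)
    (hc : ∀ k, ∃ s i, c s i = k) :
    IsClosedEmbedding (colorTuple (κ := κ) c) := by
  choose s i hsi using hc
  let E : Tuples n → κ → Fin 2 → Fin 2 → ℂ := fun w k =>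
    orient (s k (i k)) (reducedEntry (w (s k)) (i k))
  have hE : ∀ u : Config κ, ∀ k, E (colorTuple c u) k = lineEntry (u k) := by
    intro u k
    simp only [E]
    rw [reducedEntry_colorTuple, hsi]
  have hEreg : ∀ k a b, (fun w => E w k a b) ∈ regularC (reIm (tupleEntry (n := n))) :=
    fun k a b => orient_mem_regularC (reducedEntry_mem_regularC _ _ _ _)
  have hinj : Function.Injective (colorTuple (κ := κ) c) := by
    intro u v h
    refine funext fun k => eq_of_lineEntry_eq fun a b => ?_
    rw [← hE u, h, hE v]
  have hind : IsInducing (colorTuple (κ := κ) c) := by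
    refine (Config.isZariski κ).isInducing (Tuples.isZariski n) (reIm_mem_regular ?_)
      (reIm_mem_regular ?_)
    · rintro ⟨s, a, b⟩
      simp only [tupleEntry, projEntry_colorTuple]
      exact prod_mem_regularC fun j _ => orient_mem_regularC (Config.lineEntry_mem_regularC _ _ _)
    · rintro ⟨k, a, b⟩
      simp only [Config.entry, ← hE]
      refine orient_mem_regularC (sum_mem_regularC fun t _ => ?_)
      by_cases h : t (i k) = 0
      · simp only [h, if_true]
        exact coord_mem_regularC (fun u : Config κ => tupleEntry (colorTuple c u)) (_, _, _)
      · simpa only [h, if_false] using const_mem_regularC _ _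
  refine ⟨⟨hind, hinj⟩, ?_⟩
  -- A tuple is in the image when the matrices read off from it are rank-one projections and
  -- rebuilding the tuple from them gives it back.
  have hrange : Set.range (colorTuple (κ := κ) c) =
      (⋂ k, {w | E w k 0 0 + E w k 1 1 = 1} ∩
        ((⋂ a, ⋂ b, {w | (starRingEnd ℂ) (E w k a b) = E w k b a}) ∩
        {w | E w k 0 0 * E w k 1 1 = E w k 0 1 * E w k 1 0})) ∩
      ⋂ t, ⋂ a : Vertex n, ⋂ b : Vertex n,
        {w | projEntry (w t) a b = ∏ j, orient (t j) (E w (c t j)) (a j) (b j)} := by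
    ext w
    simp only [Set.mem_inter_iff, Set.mem_iInter, Set.mem_ofPred_eq]
    constructor
    · rintro ⟨u, rfl⟩
      refine ⟨fun k => ⟨?_, fun a b => ?_, ?_⟩, fun t a b => ?_⟩
      · rw [hE, ← Fin.sum_univ_two (f := fun a => lineEntry (u k) a a), sum_lineEntry]
      · rw [hE, conj_lineEntry]
      · rw [hE, lineEntry_mul_lineEntry]
      · simp only [projEntry_colorTuple, hE]
    · rintro ⟨h1, h2⟩
      obtain ⟨u, hu⟩ : ∃ u : Config κ, ∀ k a b, lineEntry (u k) a b = E w k a b :=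
        Classical.skolem.1 fun k => exists_lineEntry_eq (h1 k).1 (h1 k).2.1 (h1 k).2.2
      have hu' : ∀ k, lineEntry (u k) = E w k := fun k => by ext a b; exact hu k a b
      refine ⟨u, funext fun t => eq_of_lineEntry_eq fun a b => ?_⟩
      rw [← projEntry_eq_lineEntry, ← projEntry_eq_lineEntry, h2, projEntry_colorTuple]
      simp only [hu']
  have hZ := Tuples.isZariski n
  rw [hrange]
  refine (isClosed_iInter fun k => (hZ.isClosed_eq ?_ (const_mem_regularC _ _)).inter
    ((isClosed_iInter fun a => isClosed_iInter fun b => hZ.isClosed_eq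
      (conj_mem_regularC (hEreg k a b)) (hEreg k b a)).inter (hZ.isClosed_eq ?_ ?_))).inter
    (isClosed_iInter fun t => isClosed_iInter fun a => isClosed_iInter fun b => hZ.isClosed_eq
      (projEntry_mem_regularC _ _ _)
      (prod_mem_regularC fun j _ => orient_mem_regularC (hEreg _ _ _)))
  · exact (regularC _).add_mem (hEreg k 0 0) (hEreg k 1 1)
  · exact (regularC _).mul_mem (hEreg k 0 0) (hEreg k 1 1)
  · exact (regularC _).mul_mem (hEreg k 0 1) (hEreg k 1 0)

/-! ### Reordering the members of a tuple -/

/-- List the members of a tuple in the order given by `τ`. -/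
def reorder {n : ℕ} (τ : Equiv.Perm (Vertex n)) : Tuples n ≃ₜ Tuples n where
  toFun u s := u (τ s)
  invFun u s := u (τ.symm s)
  left_inv u := by funext s; simp
  right_inv u := by funext s; simp
  continuous_toFun := (Tuples.isZariski n).continuous (Tuples.isZariski n)
    (reIm_mem_regular fun _ => projEntry_mem_regularC _ _ _)
  continuous_invFun := (Tuples.isZariski n).continuous (Tuples.isZariski n)
    (reIm_mem_regular fun _ => projEntry_mem_regularC _ _ _)

end Qubits

end

noncomputable section

namespace Qubits

open scoped Classical

/-! ### Counting the colors -/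

/-- Distinct vertices differ in a component that has the same color at both. -/
def IsSeparating {n : ℕ} {κ : Type*} (c : Vertex n → Fin n → κ) : Prop :=
  ∀ s t, s ≠ t → ∃ i, s i ≠ t i ∧ c s i = c t i

theorem rev_ne (e : Fin 2) : e.rev ≠ e := by revert e; decide

theorem rev_eq_of_ne {e f : Fin 2} (h : e ≠ f) : e.rev = f := by revert e f; decide

theorem flipAt_same {n : ℕ} (s : Vertex n) (i : Fin n) : flipAt s i i = (s i).rev :=
  Function.update_self _ _ _

theorem flipAt_of_ne {n : ℕ} (s : Vertex n) {i j : Fin n} (h : j ≠ i) : flipAt s i j = s j :=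
  Function.update_of_ne h _ _

theorem flipAt_ne {n : ℕ} (s : Vertex n) (i : Fin n) : flipAt s i ≠ s := fun h =>
  rev_ne (s i) (by rw [← flipAt_same, h])

theorem flipAt_flipAt {n : ℕ} (s : Vertex n) (i : Fin n) : flipAt (flipAt s i) i = s := by
  ext1 j
  rcases eq_or_ne j i with rfl | h
  · rw [flipAt_same, flipAt_same, Fin.rev_rev]
  · rw [flipAt_of_ne _ h, flipAt_of_ne _ h]

/-- Neighbors differ in one component only, so that component must be the one that separates them.
This is why a separating assignment of colors to components is an edge coloring. -/
theorem IsSeparating.flipAt {n : ℕ} {κ : Type*} {c : Vertex n → Fin n → κ} (h : IsSeparating c)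
    (s : Vertex n) (i : Fin n) : c (flipAt s i) i = c s i := by
  obtain ⟨j, hj, hc⟩ := h _ _ (flipAt_ne s i)
  rcases eq_or_ne j i with rfl | hji
  · exact hc
  · exact absurd (flipAt_of_ne s hji) hj

/-- The sign character of a bit. -/
def bitSign (e : Fin 2) : ℝ := if e = 0 then 1 else -1

theorem bitSign_rev (e : Fin 2) : bitSign e.rev = -bitSign e := by
  fin_cases e <;> simp [bitSign, Fin.rev]

theorem bitSign_mul_self (e : Fin 2) : bitSign e * bitSign e = 1 := by
  fin_cases e <;> simp [bitSign]

section Count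

variable {n : ℕ} {κ : Type*} {c : Vertex n → Fin n → κ}

/-- Flip the components whose direction and color belong to `y`. -/
def twist (c : Vertex n → Fin n → κ) (y : Fin n → κ → Prop) (s : Vertex n) : Vertex n := fun i =>
  if y i (c s i) then (s i).rev else s i

/-- Where two vertices are separated they have the same color, so `twist` flips both bits or neither
and they stay different. Thus `twist` permutes the vertices. -/
theorem IsSeparating.sum_twist (h : IsSeparating c) (y : Fin n → κ → Prop) (f : Vertex n → ℝ) :
    ∑ s, f (twist c y s) = ∑ s, f s := by
  have hinj : Function.Injective (twist c y) := by
    intro s t hst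
    by_contra hne
    obtain ⟨i, hi, hc⟩ := h s t hne
    have := congrFun hst i
    simp only [twist, hc] at this
    split_ifs at this
    · exact hi (Fin.rev_injective this)
    · exact hi this
  exact (Equiv.ofBijective _ (Finite.injective_iff_bijective.1 hinj)).sum_comp f

/-- The signed indicator function of a color in a given direction. -/
def colorSign (c : Vertex n → Fin n → κ) (p : Fin n × κ) (s : Vertex n) : ℝ :=
  if c s p.1 = p.2 then bitSign (s p.1) else 0

theorem bitSign_twist_same (p : Fin n × κ) (y : Fin n → κ → Prop)
    (hy : ∀ r, y p.1 r ↔ r = p.2) (s : Vertex n) :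
    bitSign (twist c y s p.1) = bitSign (s p.1) - 2 * colorSign c p s := by
  unfold twist colorSign
  simp only [hy]
  split_ifs
  · rw [bitSign_rev]; ring
  · ring

theorem bitSign_twist_of_not (i : Fin n) (y : Fin n → κ → Prop) (hy : ∀ r, ¬y i r)
    (s : Vertex n) : bitSign (twist c y s i) = bitSign (s i) := by
  unfold twist
  rw [if_neg (hy _)]

/-- Flipping the components in the class `p` subtracts twice this sum from the total sign in the
direction `p.1`, yet leaves that total unchanged. -/
theorem IsSeparating.sum_colorSign (h : IsSeparating c) (p : Fin n × κ) :
    ∑ s, colorSign c p s = 0 := by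
  have h1 := h.sum_twist (fun i r => (i, r) = p) fun s => bitSign (s p.1)
  simp only [bitSign_twist_same (c := c) p (fun i r => (i, r) = p) (by simp [Prod.ext_iff]),
    Finset.sum_sub_distrib, ← Finset.mul_sum] at h1
  linarith

/-- In one direction, different colors have disjoint supports. In two directions, four times the
product is an alternating sum over flipping neither, `p`, `q` or both, and the four totals agree. -/
theorem IsSeparating.sum_colorSign_mul (h : IsSeparating c) {p q : Fin n × κ} (hpq : p ≠ q) :
    ∑ s, colorSign c p s * colorSign c q s = 0 := by
  by_cases hi : p.1 = q.1
  · refine Finset.sum_eq_zero fun s _ => ?_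
    unfold colorSign
    rw [hi]
    split_ifs with h1 h2
    · exact absurd (Prod.ext hi (h1.symm.trans h2)) hpq
    all_goals ring
  · have hi' : q.1 ≠ p.1 := fun h => hi h.symm
    have h1 := h.sum_twist (fun i r => (i, r) = p) fun s => bitSign (s p.1) * bitSign (s q.1)
    have h2 := h.sum_twist (fun i r => (i, r) = q) fun s => bitSign (s p.1) * bitSign (s q.1)
    have h3 := h.sum_twist (fun i r => (i, r) = p ∨ (i, r) = q) fun s =>
      bitSign (s p.1) * bitSign (s q.1)
    simp only [bitSign_twist_same (c := c) p (fun i r => (i, r) = p) (by simp [Prod.ext_iff]),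
      bitSign_twist_of_not (c := c) q.1 (fun i r => (i, r) = p) (by simp [Prod.ext_iff, hi'])] at h1
    simp only [bitSign_twist_same (c := c) q (fun i r => (i, r) = q) (by simp [Prod.ext_iff]),
      bitSign_twist_of_not (c := c) p.1 (fun i r => (i, r) = q) (by simp [Prod.ext_iff, hi])] at h2
    simp only [bitSign_twist_same (c := c) p (fun i r => (i, r) = p ∨ (i, r) = q)
        (by simp [Prod.ext_iff, hi]),
      bitSign_twist_same (c := c) q (fun i r => (i, r) = p ∨ (i, r) = q)
        (by simp [Prod.ext_iff, hi'])] at h3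
    have h4 : ∀ s, colorSign c p s * colorSign c q s =
        ((bitSign (s p.1) - 2 * colorSign c p s) * (bitSign (s q.1) - 2 * colorSign c q s) -
          (bitSign (s p.1) - 2 * colorSign c p s) * bitSign (s q.1) -
          bitSign (s p.1) * (bitSign (s q.1) - 2 * colorSign c q s) +
          bitSign (s p.1) * bitSign (s q.1)) / 4 := fun s => by ring
    simp only [h4, ← Finset.sum_div, Finset.sum_add_distrib, Finset.sum_sub_distrib, h1, h2, h3]
    ring

/-- The pairs of a direction and a color that occurs in this direction. -/
abbrev DirColor (c : Vertex n → Fin n → κ) : Type _ :=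
  Set.range fun a : Vertex n × Fin n => (a.2, c a.1 a.2)

/-- The matrix of the constant function and of the signed indicators of the colors. -/
def signMatrix (c : Vertex n → Fin n → κ) : Matrix (Option (DirColor c)) (Vertex n) ℝ
  | none, _ => 1
  | some p, s => colorSign c p.1 s

/-- The squared lengths of the rows of the sign matrix. -/
def signNorm (c : Vertex n → Fin n → κ) (p : Option (DirColor c)) : ℝ :=
  ∑ s, signMatrix c p s * signMatrix c p s

theorem signNorm_none : signNorm c none = 2 ^ n := by
  simp [signNorm, signMatrix]

theorem signNorm_some (p : DirColor c) :
    signNorm c (some p) = (Finset.univ.filter fun s => c s p.1.1 = p.1.2).card := by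
  rw [signNorm, Finset.card_filter]
  push_cast
  refine Finset.sum_congr rfl fun s _ => ?_
  simp only [signMatrix, colorSign]
  split_ifs
  · exact bitSign_mul_self _
  · ring

theorem signNorm_pos (p : Option (DirColor c)) : 0 < signNorm c p := by
  rcases p with _ | ⟨_, ⟨s, i⟩, rfl⟩
  · rw [signNorm_none]; positivity
  · rw [signNorm_some]
    exact_mod_cast Finset.card_pos.2 ⟨s, by simp⟩

/-- The rows are orthogonal and nonzero, so the transpose scaled by the squared row lengths is a
right inverse. -/
theorem IsSeparating.signMatrix_mul (h : IsSeparating c) :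
    signMatrix c * (Matrix.of fun s p => signMatrix c p s / signNorm c p) = 1 := by
  ext p q
  rw [Matrix.mul_apply, Matrix.one_apply]
  simp only [Matrix.of_apply, ← mul_div_assoc, ← Finset.sum_div]
  split_ifs with hpq
  · subst hpq
    exact div_self (signNorm_pos p).ne'
  · rw [div_eq_zero_iff]
    left
    rcases p with _ | p <;> rcases q with _ | q
    · exact absurd rfl hpq
    · simpa [signMatrix] using h.sum_colorSign q.1
    · simpa [signMatrix] using h.sum_colorSign p.1
    · exact h.sum_colorSign_mul fun h0 => hpq (congrArg some (Subtype.ext h0))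

theorem IsSeparating.card_dirColor (h : IsSeparating c) :
    Nat.card (DirColor c) + 1 ≤ 2 ^ n := by
  have hinj : Function.Injective
      (Matrix.of fun s p => signMatrix c p s / signNorm c p).mulVecLin := by
    refine Function.LeftInverse.injective (g := (signMatrix c).mulVec) fun v => ?_
    rw [Matrix.mulVecLin_apply, Matrix.mulVec_mulVec, h.signMatrix_mul, Matrix.one_mulVec]
  have := LinearMap.finrank_le_finrank_of_injective hinj
  simpa [Nat.card_eq_fintype_card] using this

/-- If there are `2ⁿ - 1` colors, then some direction has only one color. -/
theorem IsSeparating.exists_direction {n : ℕ} {c : Vertex (n + 1) → Fin (n + 1) → κ}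
    (h : IsSeparating c) (hcard : Nat.card (DirColor c) + 1 = 2 ^ (n + 1)) :
    ∃ i r, ∀ s, c s i = r := by
  -- With the maximal number of rows the matrix is square and the right inverse is also a left
  -- inverse: the completeness relation for pairs of vertices.
  have h1 := (Matrix.mul_eq_one_comm_of_card_eq _ _ _ (by simpa [Nat.card_eq_fintype_card] using hcard)).1 h.signMatrix_mul
  let s : Vertex (n + 1) := fun _ => 0
  let t : Vertex (n + 1) := fun _ => 1
  have hst : s ≠ t := fun h0 => absurd (congrFun h0 0) (by simp [s, t])
  have h2 := congrFun (congrFun h1 s) t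
  rw [Matrix.one_apply_ne hst, Matrix.mul_apply, Fintype.sum_option] at h2
  simp only [Matrix.of_apply, signNorm_none, signMatrix] at h2
  -- Opposite vertices have opposite signs in every direction. Each color shared there contributes
  -- minus the inverse of its squared length, and these terms must cancel `1 / 2 ^ (n + 1)` from the
  -- constant row.
  let a : DirColor c → ℝ := fun p =>
    if c s p.1.1 = p.1.2 ∧ c t p.1.1 = p.1.2 then 1 / signNorm c (some p) else 0
  have ha : ∀ p, a p = -(colorSign c p.1 s / signNorm c (some p) * colorSign c p.1 t) := by
    intro p
    simp only [a, colorSign, ite_and, s, t, bitSign]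
    split_ifs <;> simp_all
  have hsum : ∑ p, a p = 1 / 2 ^ (n + 1) := by
    simp only [ha, Finset.sum_neg_distrib]
    linarith
  have ha0 : ∀ p, 0 ≤ a p := by
    intro p
    simp only [a]
    split_ifs
    · exact (one_div_pos.2 (signNorm_pos _)).le
    · exact le_rfl
  obtain ⟨p, hp⟩ : ∃ p, a p ≠ 0 := by
    by_contra! H
    rw [Finset.sum_eq_zero fun p _ => H p] at hsum
    exact absurd hsum (one_div_pos.2 (by positivity)).ne
  have hle : a p ≤ 1 / 2 ^ (n + 1) := by
    rw [← hsum]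
    exact Finset.single_le_sum (fun q _ => ha0 q) (Finset.mem_univ p)
  have hap : a p = 1 / signNorm c (some p) := by
    by_contra h0
    exact hp (if_neg fun hc => h0 (if_pos hc))
  -- A single nonzero term is already at most the total, so the color is carried by at least `2 ^ (n
  -- + 1)` vertices, that is, by all of them.
  rw [hap, one_div_le_one_div (signNorm_pos _) (by positivity), signNorm_some] at hle
  have hle' : Fintype.card (Vertex (n + 1)) ≤
      (Finset.univ.filter fun s => c s p.1.1 = p.1.2).card := by
    simp only [Fintype.card_fun, Fintype.card_fin]
    exact_mod_cast hle
  have huniv := Finset.eq_univ_of_card _ (le_antisymm (Finset.card_le_univ _) hle')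
  refine ⟨p.1.1, p.1.2, fun s => ?_⟩
  have := Finset.mem_univ s
  rw [← huniv] at this
  exact (Finset.mem_filter.1 this).2

end Count

end Qubits

end

noncomputable section

namespace Qubits

open scoped Classical

/-! ### Colorings of the hypercube -/

section Coloring

variable {n : ℕ}

theorem exists_eq_flipAt {s t : Vertex n} (h : (hypercube n).Adj s t) : ∃ i, t = flipAt s i := by
  have h' : hammingDist s t = 1 := h
  obtain ⟨i, hi⟩ := Finset.card_eq_one.1 h'
  have hd : ∀ j, s j ≠ t j ↔ j = i := fun j => by
    rw [← Finset.mem_singleton, ← hi]; simp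
  refine ⟨i, funext fun j => ?_⟩
  rcases eq_or_ne j i with rfl | hj
  · rw [flipAt_same, rev_eq_of_ne ((hd j).2 rfl)]
  · rw [flipAt_of_ne _ hj]
    by_contra h0
    exact hj ((hd j).1 fun h1 => h0 h1.symm)

theorem exists_edge_eq (e : (hypercube n).edgeSet) :
    ∃ s i, e = ⟨s(s, flipAt s i), adj_flipAt s i⟩ := by
  obtain ⟨e, he⟩ := e
  induction e using Sym2.ind with
  | h s t =>
    obtain ⟨i, hi⟩ := exists_eq_flipAt (s := s) (t := t) he
    subst hi
    exact ⟨s, i, rfl⟩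

theorem vertexColor_ext {C D : Coloring n} (h : ∀ s i, vertexColor C s i = vertexColor D s i) :
    C = D := by
  funext e
  obtain ⟨s, i, rfl⟩ := exists_edge_eq e
  exact h s i

/-- An edge is described by a direction and either of its endpoints; the hypothesis says that both
descriptions give the same color. -/
theorem exists_vertexColor_eq (c : Vertex n → Fin n → ℕ) (h : ∀ s i, c (flipAt s i) i = c s i) :
    ∃ C : Coloring n, ∀ s i, vertexColor C s i = c s i := by
  choose a i hai using exists_edge_eq (n := n)
  refine ⟨fun e => c (a e) (i e), fun s j => ?_⟩
  change c (a ⟨s(s, flipAt s j), adj_flipAt s j⟩) (i ⟨s(s, flipAt s j), adj_flipAt s j⟩) = c s j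
  have he := congrArg Subtype.val (hai ⟨s(s, flipAt s j), adj_flipAt s j⟩)
  revert he
  generalize a ⟨s(s, flipAt s j), adj_flipAt s j⟩ = t
  generalize i ⟨s(s, flipAt s j), adj_flipAt s j⟩ = k
  intro he
  have hdir : ∀ {s t : Vertex n} {j k}, flipAt s j = flipAt t k → s = t → j = k := by
    rintro s _ j k h rfl
    by_contra hjk
    have := congrFun h j
    rw [flipAt_same, flipAt_of_ne _ hjk] at this
    exact rev_ne _ this
  rcases Sym2.eq_iff.1 he with ⟨h1, h2⟩ | ⟨h1, h2⟩
  · rw [hdir h2 h1, h1]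
  · have hkj : flipAt t k = flipAt t j := by rw [← h1, ← h2, flipAt_flipAt]
    rw [hdir hkj rfl, ← h2, h]

theorem mem_range_iff {C : Coloring n} {r : ℕ} : r ∈ Set.range C ↔ ∃ s i, vertexColor C s i = r := by
  constructor
  · rintro ⟨e, rfl⟩
    obtain ⟨s, i, rfl⟩ := exists_edge_eq e
    exact ⟨s, i, rfl⟩
  · rintro ⟨s, i, rfl⟩
    exact Set.mem_range_self _

/-- Only an inequality, since a coloring may use one color in several directions. -/
theorem ncard_range_le_card_dirColor (C : Coloring n) :
    (Set.range C).ncard ≤ Nat.card (DirColor (vertexColor C)) := by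
  have : Set.range C ⊆ Set.range fun p : DirColor (vertexColor C) => p.1.2 := by
    intro r hr
    obtain ⟨s, i, rfl⟩ := mem_range_iff.1 hr
    exact ⟨⟨_, ⟨(s, i), rfl⟩⟩, rfl⟩
  refine (Set.ncard_le_ncard this (Set.toFinite _)).trans ?_
  rw [← Nat.card_coe_set_eq]
  exact Finite.card_range_le _

theorem ncard_range_add_one_le {C : Coloring n} (h : IsSeparating (vertexColor C)) :
    (Set.range C).ncard + 1 ≤ 2 ^ n :=
  (Nat.add_le_add_right (ncard_range_le_card_dirColor C) 1).trans h.card_dirColor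

/-! ### Permutation of the coordinates -/

theorem vertexColor_permute (σ : Equiv.Perm (Fin n)) (C : Coloring n) (s : Vertex n) (i : Fin n) :
    vertexColor (permute σ C) s i = vertexColor C (s ∘ σ) (σ.symm i) := by
  have h : (permIso σ).mapEdgeSet ⟨s(s, flipAt s i), adj_flipAt s i⟩ =
      ⟨s(s ∘ σ, flipAt (s ∘ σ) (σ.symm i)), adj_flipAt _ _⟩ := by
    refine Subtype.ext ?_
    change s(s ∘ σ, flipAt s i ∘ σ) = s(s ∘ σ, flipAt (s ∘ σ) (σ.symm i))
    suffices flipAt s i ∘ σ = flipAt (s ∘ σ) (σ.symm i) by rw [this]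
    ext1 j
    rcases eq_or_ne j (σ.symm i) with rfl | hj
    · rw [flipAt_same]
      simp [flipAt_same]
    · rw [flipAt_of_ne _ hj]
      exact flipAt_of_ne _ fun h => hj (by rw [← h, σ.symm_apply_apply])
  exact congrArg C h

theorem permute_one (C : Coloring n) : permute 1 C = C :=
  vertexColor_ext fun s i => vertexColor_permute 1 C s i

theorem permute_permute (σ τ : Equiv.Perm (Fin n)) (C : Coloring n) :
    permute σ (permute τ C) = permute (σ * τ) C :=
  vertexColor_ext fun s i => by
    rw [vertexColor_permute, vertexColor_permute, vertexColor_permute]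
    rfl

theorem range_permute (σ : Equiv.Perm (Fin n)) (C : Coloring n) :
    Set.range (permute σ C) = Set.range C :=
  (permIso σ).mapEdgeSet.surjective.range_comp C

theorem IsSeparating.permute {C : Coloring n} (h : IsSeparating (vertexColor C))
    (σ : Equiv.Perm (Fin n)) : IsSeparating (vertexColor (permute σ C)) := by
  intro s t hst
  obtain ⟨i, hi, hc⟩ := h (s ∘ σ) (t ∘ σ) fun h0 => hst (σ.surjective.injective_comp_right h0)
  refine ⟨σ i, hi, ?_⟩
  rw [vertexColor_permute, vertexColor_permute, σ.symm_apply_apply, hc]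

/-! ### Joining two colorings -/

theorem flipAt_succ (s : Vertex (n + 1)) (i : Fin n) :
    flipAt s i.succ 0 = s 0 ∧ Fin.tail (flipAt s i.succ) = flipAt (Fin.tail s) i := by
  refine ⟨flipAt_of_ne _ (Fin.succ_ne_zero i).symm, funext fun j => ?_⟩
  rcases eq_or_ne j i with rfl | hj
  · rw [flipAt_same]
    exact flipAt_same _ _
  · rw [flipAt_of_ne _ hj]
    exact flipAt_of_ne _ fun h => hj (Fin.succ_injective _ h)

theorem exists_isJoin (r : ℕ) (C₀ C₁ : Coloring n) : ∃ C, IsJoin r C₀ C₁ C := by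
  obtain ⟨C, hC⟩ := exists_vertexColor_eq (fun (s : Vertex (n + 1)) i => Fin.cases r (fun j =>
      if s 0 = 0 then vertexColor C₀ (Fin.tail s) j else vertexColor C₁ (Fin.tail s) j) i) (by
    intro s i
    induction i using Fin.cases with
    | zero => rfl
    | succ i =>
      have hv : ∀ (D : Coloring n) (t : Vertex n), vertexColor D (flipAt t i) i =
          vertexColor D t i := by
        intro D t
        refine congrArg D (Subtype.ext ?_)
        change s(flipAt t i, flipAt (flipAt t i) i) = s(t, flipAt t i)
        rw [flipAt_flipAt, Sym2.eq_swap]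
      simp only [Fin.cases_succ, (flipAt_succ s i).1, (flipAt_succ s i).2, hv])
  exact ⟨C, fun s => ⟨hC s 0, fun i => hC s i.succ⟩⟩

variable {r : ℕ} {C₀ C₁ : Coloring n} {C : Coloring (n + 1)}

theorem IsJoin.range_eq (h : IsJoin r C₀ C₁ C) :
    Set.range C = insert r (Set.range C₀ ∪ Set.range C₁) := by
  ext k
  rw [Set.mem_insert_iff, Set.mem_union, mem_range_iff, mem_range_iff, mem_range_iff]
  constructor
  · rintro ⟨s, i, rfl⟩
    induction i using Fin.cases with
    | zero => exact Or.inl (h s).1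
    | succ i =>
      rw [(h s).2]
      split_ifs
      · exact Or.inr (Or.inl ⟨_, _, rfl⟩)
      · exact Or.inr (Or.inr ⟨_, _, rfl⟩)
  · rintro (rfl | ⟨s, i, rfl⟩ | ⟨s, i, rfl⟩)
    · exact ⟨fun _ => 0, 0, (h _).1⟩
    · exact ⟨Fin.cons 0 s, i.succ, by simp [(h _).2]⟩
    · exact ⟨Fin.cons 1 s, i.succ, by simp [(h _).2]⟩

theorem IsJoin.isSeparating (h : IsJoin r C₀ C₁ C) (h₀ : IsSeparating (vertexColor C₀))
    (h₁ : IsSeparating (vertexColor C₁)) : IsSeparating (vertexColor C) := by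
  intro s t hst
  by_cases h0 : s 0 = t 0
  · have ht : Fin.tail s ≠ Fin.tail t := by
      intro h'
      refine hst ?_
      rw [← Fin.cons_self_tail s, ← Fin.cons_self_tail t, h0, h']
    by_cases hs : s 0 = 0
    · obtain ⟨i, hi, hc⟩ := h₀ _ _ ht
      exact ⟨i.succ, hi, by rw [(h s).2, (h t).2, if_pos hs, if_pos (h0 ▸ hs), hc]⟩
    · obtain ⟨i, hi, hc⟩ := h₁ _ _ ht
      exact ⟨i.succ, hi, by rw [(h s).2, (h t).2, if_neg hs, if_neg (h0 ▸ hs), hc]⟩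
  · exact ⟨0, h0, by rw [(h s).1, (h t).1]⟩

theorem IsJoin.isSeparating_left (h : IsJoin r C₀ C₁ C) (hC : IsSeparating (vertexColor C)) :
    IsSeparating (vertexColor C₀) := by
  intro s t hst
  obtain ⟨i, hi, hc⟩ := hC (Fin.cons 0 s) (Fin.cons 0 t) fun h0 =>
    hst (Fin.cons_right_injective _ h0)
  induction i using Fin.cases with
  | zero => exact absurd rfl hi
  | succ i =>
    rw [(h _).2, (h _).2] at hc
    exact ⟨i, by simpa using hi, by simpa using hc⟩

theorem IsJoin.isSeparating_right (h : IsJoin r C₀ C₁ C) (hC : IsSeparating (vertexColor C)) :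
    IsSeparating (vertexColor C₁) := by
  intro s t hst
  obtain ⟨i, hi, hc⟩ := hC (Fin.cons 1 s) (Fin.cons 1 t) fun h0 =>
    hst (Fin.cons_right_injective _ h0)
  induction i using Fin.cases with
  | zero => exact absurd rfl hi
  | succ i =>
    rw [(h _).2, (h _).2] at hc
    exact ⟨i, by simpa using hi, by simpa using hc⟩

theorem exists_isJoin_of_vertexColor_zero (hC : IsSeparating (vertexColor C))
    (hr : ∀ s, vertexColor C s 0 = r) : ∃ C₀ C₁, IsJoin r C₀ C₁ C := by
  have hflip : ∀ (e : Fin 2) (s : Vertex n) (i : Fin n),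
      (Fin.cons e (flipAt s i) : Vertex (n + 1)) = flipAt (Fin.cons e s) i.succ := by
    intro e s i
    have := flipAt_succ (Fin.cons e s) i
    rw [← Fin.cons_self_tail (flipAt (Fin.cons e s) i.succ), this.1, this.2]
    simp
  obtain ⟨C₀, h₀⟩ := exists_vertexColor_eq
    (fun (s : Vertex n) i => vertexColor C (Fin.cons 0 s) i.succ)
    fun s i => by rw [hflip, hC.flipAt]
  obtain ⟨C₁, h₁⟩ := exists_vertexColor_eq
    (fun (s : Vertex n) i => vertexColor C (Fin.cons 1 s) i.succ)
    fun s i => by rw [hflip, hC.flipAt]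
  refine ⟨C₀, C₁, fun s => ⟨hr s, fun i => ?_⟩⟩
  rw [h₀, h₁]
  have : s = Fin.cons (s 0) (Fin.tail s) := (Fin.cons_self_tail s).symm
  split_ifs with h0
  · rw [h0] at this
    rw [← this]
  · rw [Fin.eq_one_of_ne_zero _ h0] at this
    rw [← this]

/-! ### The colorings produced by the algorithm -/

theorem IsAlgorithmic.relabel {f : ℕ → ℕ} (hf : Function.Injective f) :
    ∀ {n : ℕ} {C : Coloring n}, IsAlgorithmic n C → IsAlgorithmic n (f ∘ C)
  | 0, _, _ => trivial
  | n + 1, C, ⟨C₀, C₁, σ₀, σ₁, r, h₀, h₁, hd, hr, hj⟩ => by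
    refine ⟨f ∘ C₀, f ∘ C₁, σ₀, σ₁, f r, h₀.relabel hf, h₁.relabel hf, ?_, ?_, ?_⟩
    · rw [Set.range_comp, Set.range_comp]
      exact (Set.disjoint_image_iff hf).2 hd
    · rw [Set.range_comp, Set.range_comp, ← Set.image_union]
      rwa [hf.mem_set_image]
    · refine fun s => ⟨congrArg f (hj s).1, fun i => ?_⟩
      have := congrArg f ((hj s).2 i)
      rw [apply_ite f] at this
      exact this

theorem exists_isAlgorithmic : ∀ n, ∃ C : Coloring n, IsAlgorithmic n C
  | 0 => ⟨fun _ => 0, trivial⟩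
  | n + 1 => by
    obtain ⟨C, hC⟩ := exists_isAlgorithmic n
    -- Odd numbers color one half, positive even numbers the other, and `0` is left for the first
    -- direction.
    have h₀ : Function.Injective fun k : ℕ => 2 * k + 1 := fun a b h => by simp at h; omega
    have h₁ : Function.Injective fun k : ℕ => 2 * k + 2 := fun a b h => by simp at h; omega
    obtain ⟨D, hD⟩ := exists_isJoin 0 (permute 1 ((fun k : ℕ => 2 * k + 1) ∘ C))
      (permute 1 ((fun k : ℕ => 2 * k + 2) ∘ C))
    refine ⟨D, _, _, 1, 1, 0, hC.relabel h₀, hC.relabel h₁, ?_, ?_, hD⟩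
    · rw [Set.disjoint_left]
      rintro _ ⟨e, rfl⟩ ⟨e', h⟩
      simp only [Function.comp_apply] at h
      omega
    · rintro (⟨e, h⟩ | ⟨e, h⟩) <;> simp at h

theorem IsAlgorithmic.isSeparating :
    ∀ {n : ℕ} {C : Coloring n}, IsAlgorithmic n C → IsSeparating (vertexColor C)
  | 0, _, _ => fun s t hst => absurd (Subsingleton.elim s t) hst
  | _ + 1, _, ⟨_, _, σ₀, σ₁, _, h₀, h₁, _, _, hj⟩ =>
    hj.isSeparating (h₀.isSeparating.permute σ₀) (h₁.isSeparating.permute σ₁)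

theorem IsAlgorithmic.ncard_range :
    ∀ {n : ℕ} {C : Coloring n}, IsAlgorithmic n C → (Set.range C).ncard + 1 = 2 ^ n
  | 0, C, _ => by
    have : Set.range C = ∅ := by
      refine Set.eq_empty_of_forall_notMem fun r hr => ?_
      obtain ⟨_, i, _⟩ := mem_range_iff.1 hr
      exact i.elim0
    rw [this]
    simp
  | n + 1, C, ⟨C₀, C₁, σ₀, σ₁, r, h₀, h₁, hd, hr, hj⟩ => by
    rw [hj.range_eq, range_permute, range_permute,
      Set.ncard_insert_of_notMem hr (Set.toFinite _), Set.ncard_union_eq hd (Set.toFinite _)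
      (Set.toFinite _)]
    have := h₀.ncard_range
    have := h₁.ncard_range
    rw [pow_succ]
    omega

/-- A separating coloring with the maximal number of colors is produced by the algorithm, up to a
permutation of the coordinates. -/
theorem IsSeparating.exists_isAlgorithmic : ∀ {n : ℕ} {C : Coloring n},
    IsSeparating (vertexColor C) → (Set.range C).ncard + 1 = 2 ^ n →
      ∃ (D : Coloring n) (σ : Equiv.Perm (Fin n)), IsAlgorithmic n D ∧ C = Qubits.permute σ D
  | 0, C, _, _ => ⟨C, 1, trivial, (permute_one C).symm⟩
  | n + 1, C, hC, hcard => by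
    obtain ⟨i, r, hr⟩ := hC.exists_direction (le_antisymm hC.card_dirColor
      (hcard ▸ Nat.add_le_add_right (ncard_range_le_card_dirColor C) 1))
    let σ : Equiv.Perm (Fin (n + 1)) := Equiv.swap 0 i
    have hσ : Qubits.permute σ (Qubits.permute σ C) = C := by
      rw [permute_permute, Equiv.swap_mul_self, permute_one]
    have hD := hC.permute σ
    have hDcard : (Set.range (Qubits.permute σ C)).ncard + 1 = 2 ^ (n + 1) := by
      rw [range_permute, hcard]
    obtain ⟨C₀, C₁, hj⟩ := exists_isJoin_of_vertexColor_zero (r := r) hD fun s => by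
      rw [vertexColor_permute]
      simpa [σ] using hr _
    have hs₀ := hj.isSeparating_left hD
    have hs₁ := hj.isSeparating_right hD
    -- Each half has at most `2 ^ n - 1` colors and the total is `2 ^ (n + 1) - 1`, so `r` is new,
    -- the palettes are disjoint and both halves are maximal.
    have hb₀ := ncard_range_add_one_le hs₀
    have hb₁ := ncard_range_add_one_le hs₁
    have hunion := Set.ncard_union_add_ncard_inter (Set.range C₀) (Set.range C₁)
    rw [hj.range_eq, pow_succ] at hDcard
    have hnot : r ∉ Set.range C₀ ∪ Set.range C₁ := fun h => by
      rw [Set.insert_eq_of_mem h] at hDcard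
      omega
    rw [Set.ncard_insert_of_notMem hnot (Set.toFinite _)] at hDcard
    have hdisj : Disjoint (Set.range C₀) (Set.range C₁) := by
      rw [Set.disjoint_iff_inter_eq_empty, ← Set.ncard_eq_zero (Set.toFinite _)]
      omega
    obtain ⟨D₀, σ₀, hD₀, rfl⟩ := hs₀.exists_isAlgorithmic (by omega)
    obtain ⟨D₁, σ₁, hD₁, rfl⟩ := hs₁.exists_isAlgorithmic (by omega)
    rw [range_permute, range_permute] at hdisj hnot
    exact ⟨_, σ, ⟨D₀, D₁, σ₀, σ₁, r, hD₀, hD₁, hdisj, hnot, hj⟩, hσ.symm⟩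

end Coloring

end Qubits

end

noncomputable section

namespace Qubits

open scoped LinearAlgebra.Projectivization Classical
open Topology

/-! ### Orthogonal product states -/

theorem inner_pureTensor {n : ℕ} (v w : Fin n → Qubit) :
    inner ℂ (pureTensor v) (pureTensor w) = ∏ i, inner ℂ (v i) (w i) := by
  simp only [PiLp.inner_apply, Finset.prod_univ_sum, Fintype.piFinset_univ, pureTensor]
  simp [map_prod, Finset.prod_mul_distrib]

theorem productState_isOrtho_iff {n : ℕ} (x y : Fin n → ℙ ℂ Qubit) :
    (productState x).submodule ⟂ (productState y).submodule ↔ ∃ i, y i = hat (x i) := by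
  simp only [productState, Projectivization.submodule_mk, Submodule.isOrtho_span,
    Set.mem_singleton_iff, forall_eq, inner_pureTensor, Finset.prod_eq_zero_iff, Finset.mem_univ,
    true_and, inner_rep_eq_zero_iff]

theorem colorTuple_mem_UOB {n : ℕ} {κ : Type*} {c : Vertex n → Fin n → κ} (hc : IsSeparating c)
    (u : Config κ) : colorTuple c u ∈ UOB n := by
  refine ⟨fun s => ⟨_, rfl⟩, fun s t hst => ?_⟩
  obtain ⟨i, hi, hci⟩ := hc s t hst
  refine (productState_isOrtho_iff _ _).2 ⟨i, ?_⟩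
  rw [hci]
  by_cases hs : s i = 0
  · have ht : t i ≠ 0 := fun h => hi (hs.trans h.symm)
    rw [if_pos hs, if_neg ht]
  · have ht : t i = 0 := by
      by_contra ht
      exact hi ((Fin.eq_one_of_ne_zero _ hs).trans (Fin.eq_one_of_ne_zero _ ht).symm)
    rw [if_neg hs, if_pos ht, hat_hat]

theorem reorder_mem_UOB {n : ℕ} (τ : Equiv.Perm (Vertex n)) {u : Tuples n} (hu : u ∈ UOB n) :
    reorder τ u ∈ UOB n :=
  ⟨fun s => hu.1 (τ s), fun _ _ hst => hu.2 _ _ fun h => hst (τ.injective h)⟩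

/-- Every unentangled orthogonal basis is parametrized by a separating coloring. -/
theorem exists_eq_reorder_colorTuple {n : ℕ} {u : Tuples n} (hu : u ∈ UOB n) :
    ∃ (c : Vertex n → Fin n → ℕ) (w : Config ℕ) (τ : Equiv.Perm (Vertex n)),
      (∀ s i, c s i < Fintype.card (Vertex n × Fin n)) ∧ IsSeparating c ∧
        u = reorder τ (colorTuple c w) := by
  choose x hx using hu.1
  have hortho : ∀ {s t}, s ≠ t → ∃ i, x t i = hat (x s i) := by
    intro _ _ hst
    have := hu.2 _ _ hst
    rwa [hx, hx, productState_isOrtho_iff] at this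
  -- `K` is the color as an invariant; `g` selects one occurrence of each color, whose state serves
  -- as the reference for the bits `b`.
  let K : Vertex n × Fin n → Fin n × Set (ℙ ℂ Qubit) := fun a =>
    (a.2, {x a.1 a.2, hat (x a.1 a.2)})
  let g : Vertex n × Fin n → Vertex n × Fin n := fun a =>
    Set.rangeSplitting K ⟨K a, Set.mem_range_self a⟩
  have hKg : ∀ a, K (g a) = K a := fun a =>
    Set.apply_rangeSplitting K ⟨K a, Set.mem_range_self a⟩
  have hgK : ∀ a b, K a = K b → g a = g b := by
    intro a b h
    simp only [g, h]
  let N := Fintype.card (Vertex n × Fin n)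
  let E : Vertex n × Fin n ≃ Fin N := Fintype.equivFin _
  let base : Vertex n × Fin n → ℙ ℂ Qubit := fun a => x (g a).1 (g a).2
  obtain ⟨p⟩ : Nonempty (Config Unit) := inferInstance
  -- Numbers from `N` on are not used as colors and get an arbitrary state.
  let w : Config ℕ := fun k => if h : k < N then x (E.symm ⟨k, h⟩).1 (E.symm ⟨k, h⟩).2 else p ()
  let col : Vertex n → Fin n → ℕ := fun s i => (E (g (s, i))).1
  have hw : ∀ s i, w (col s i) = base (s, i) := by
    intro s i
    have h : (E (g (s, i))).1 < N := (E (g (s, i))).2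
    simp only [w, col, dif_pos h, Fin.eta, E.symm_apply_apply, base]
  have hbase : ∀ s i, x s i = base (s, i) ∨ x s i = hat (base (s, i)) := by
    intro s i
    have h := hKg (s, i)
    simp only [K, Prod.mk.injEq] at h
    have hmem : x s i ∈ ({x (g (s, i)).1 (g (s, i)).2, hat (x (g (s, i)).1 (g (s, i)).2)} :
        Set (ℙ ℂ Qubit)) := by
      rw [h.2]
      exact Set.mem_insert _ _
    exact hmem
  let b : Vertex n → Vertex n := fun s i => if x s i = base (s, i) then 0 else 1
  have hxb : ∀ s i, x s i = if b s i = 0 then base (s, i) else hat (base (s, i)) := by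
    intro s i
    rcases hbase s i with h | h
    · simp only [b, if_pos h, if_true]
      exact h
    · have : x s i ≠ base (s, i) := by
        rw [h]
        exact hat_ne _
      simp only [b, if_neg this]
      exact h
  have hsep : ∀ s t, s ≠ t → ∃ i, b s i ≠ b t i ∧ col s i = col t i := by
    intro s t hst
    obtain ⟨i, hi⟩ := hortho hst
    have hK : K (s, i) = K (t, i) := by
      simp only [K, hi, hat_hat]
      rw [Set.pair_comm]
    have hg := hgK _ _ hK
    refine ⟨i, fun hb => ?_, by simp only [col, hg]⟩
    have h1 := hxb s i
    have h2 := hxb t i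
    have hbb : base (s, i) = base (t, i) := by simp only [base, hg]
    rw [hb, hbb, ← h2, hi] at h1
    exact hat_ne _ h1.symm
  have hbinj : Function.Injective b := by
    intro s t hst
    by_contra hne
    obtain ⟨i, hi, _⟩ := hsep s t hne
    exact hi (congrFun hst i)
  -- There are as many members as bit strings, so injectivity makes the bits a relabelling of the
  -- basis.
  let τ : Equiv.Perm (Vertex n) := Equiv.ofBijective b (Finite.injective_iff_bijective.1 hbinj)
  have hτ : ∀ s, τ s = b s := fun s => rfl
  refine ⟨fun s i => col (τ.symm s) i, w, τ, fun s i => (E (g (τ.symm s, i))).2, ?_, ?_⟩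
  · intro s t hst
    obtain ⟨i, hi, hc⟩ := hsep (τ.symm s) (τ.symm t) fun h => hst (τ.symm.injective h)
    rw [← hτ, ← hτ, τ.apply_symm_apply, τ.apply_symm_apply] at hi
    exact ⟨i, hi, hc⟩
  · funext s
    rw [hx s]
    change _ = productState fun i => if τ s i = 0 then w (col (τ.symm (τ s)) i) else
      hat (w (col (τ.symm (τ s)) i))
    simp only [τ.symm_apply_apply, hw]
    congr 1
    funext i
    exact hxb s i

/-! ### The irreducible pieces of the variety of unentangled orthogonal bases -/

section Pieces

variable {n : ℕ}

theorem colorTuple_congr {κ κ' : Type*} {c : Vertex n → Fin n → κ} {c' : Vertex n → Fin n → κ'}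
    {u : Config κ} {u' : Config κ'} (h : ∀ s i, u (c s i) = u' (c' s i)) :
    colorTuple c u = colorTuple c' u' := by
  funext s
  simp only [colorTuple, h]

/-- States given to unused colors are irrelevant, so all colorings can share the parameter space
`Config ℕ`, which makes them easy to compare and to join. -/
theorem range_Phi (C : Coloring n) :
    Set.range (Phi C) = Set.range (colorTuple (κ := ℕ) (vertexColor C)) := by
  apply Set.Subset.antisymm
  · rintro _ ⟨u, rfl⟩
    obtain ⟨p⟩ : Nonempty (Config Unit) := inferInstance
    refine ⟨Config.extend Subtype.val (p ()) u, ?_⟩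
    refine colorTuple_congr (u' := (u : Config (Set.range C)))
      (c' := fun s i => (⟨vertexColor C s i, Set.mem_range_self _⟩ : Set.range C)) fun s i => ?_
    exact Config.extend_apply Subtype.val_injective (p ()) u
      (⟨vertexColor C s i, Set.mem_range_self _⟩ : Set.range C)
  · rintro _ ⟨u, rfl⟩
    exact ⟨fun k => u k, rfl⟩

/-- The bases parametrized by a coloring, listed in the order given by `τ`. -/
def piece (C : Coloring n) (τ : Equiv.Perm (Vertex n)) : Set (Tuples n) :=
  reorder τ '' Set.range (Phi C)

theorem isClosedEmbedding_reorder_Phi (C : Coloring n) (τ : Equiv.Perm (Vertex n)) :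
    IsClosedEmbedding fun u : Config (Set.range C) => reorder τ (Phi C u) := by
  refine (reorder τ).isClosedEmbedding.comp (isClosedEmbedding_colorTuple
    (fun s i => (⟨vertexColor C s i, Set.mem_range_self _⟩ : Set.range C)) ?_)
  rintro ⟨r, hr⟩
  obtain ⟨s, i, rfl⟩ := mem_range_iff.1 hr
  exact ⟨s, i, rfl⟩

theorem piece_eq_range (C : Coloring n) (τ : Equiv.Perm (Vertex n)) :
    piece C τ = Set.range fun u : Config (Set.range C) => reorder τ (Phi C u) :=
  (Set.range_comp _ _).symm

theorem isClosed_piece (C : Coloring n) (τ : Equiv.Perm (Vertex n)) : IsClosed (piece C τ) := by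
  rw [piece_eq_range]
  exact (isClosedEmbedding_reorder_Phi C τ).isClosed_range

theorem isIrreducible_piece (C : Coloring n) (τ : Equiv.Perm (Vertex n)) :
    IsIrreducible (piece C τ) := by
  rw [piece_eq_range, ← Set.image_univ]
  exact (IrreducibleSpace.isIrreducible_univ _).image _
    (isClosedEmbedding_reorder_Phi C τ).continuous.continuousOn

theorem topologicalKrullDim_piece (C : Coloring n) (τ : Equiv.Perm (Vertex n)) :
    topologicalKrullDim (piece C τ) = topologicalKrullDim (Config (Set.range C)) := by
  rw [piece_eq_range]
  exact (IsHomeomorph.topologicalKrullDim_eq _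
    (isClosedEmbedding_reorder_Phi C τ).isEmbedding.toHomeomorph.isHomeomorph).symm

theorem topologicalKrullDim_piece_le {C D : Coloring n} {τ υ : Equiv.Perm (Vertex n)}
    (h : (Set.range C).ncard ≤ (Set.range D).ncard) :
    topologicalKrullDim (piece C τ) ≤ topologicalKrullDim (piece D υ) := by
  rw [topologicalKrullDim_piece, topologicalKrullDim_piece]
  refine Config.topologicalKrullDim_le ?_
  rwa [← Nat.card_eq_fintype_card, ← Nat.card_eq_fintype_card, Nat.card_coe_set_eq,
    Nat.card_coe_set_eq]

theorem topologicalKrullDim_piece_lt {C D : Coloring n} {τ υ : Equiv.Perm (Vertex n)}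
    (h : (Set.range C).ncard < (Set.range D).ncard) :
    topologicalKrullDim (piece C τ) < topologicalKrullDim (piece D υ) := by
  rw [topologicalKrullDim_piece, topologicalKrullDim_piece]
  refine Config.topologicalKrullDim_lt ?_
  rwa [← Nat.card_eq_fintype_card, ← Nat.card_eq_fintype_card, Nat.card_coe_set_eq,
    Nat.card_coe_set_eq]

theorem piece_subset_UOB {C : Coloring n} (hC : IsSeparating (vertexColor C))
    (τ : Equiv.Perm (Vertex n)) : piece C τ ⊆ UOB n := by
  unfold piece
  rw [range_Phi]
  rintro _ ⟨_, ⟨u, rfl⟩, rfl⟩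
  exact reorder_mem_UOB τ (colorTuple_mem_UOB hC u)

/-- The pieces for the separating colorings with a fixed finite palette. -/
def pieces (n : ℕ) : Set (Set (Tuples n)) :=
  (fun a : Coloring n × Equiv.Perm (Vertex n) => piece a.1 a.2) ''
    ({C | (∀ e, C e ∈ Set.Iio (Fintype.card (Vertex n × Fin n))) ∧
      IsSeparating (vertexColor C)} ×ˢ Set.univ)

theorem finite_pieces (n : ℕ) : (pieces n).Finite :=
  (((Set.Finite.pi' fun _ => Set.finite_Iio _).subset fun _ h => h.1).prod Set.finite_univ).image _

theorem sUnion_pieces (n : ℕ) : ⋃₀ pieces n = UOB n := by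
  apply Set.Subset.antisymm
  · rintro u ⟨_, ⟨⟨C, τ⟩, ⟨⟨_, hC⟩, _⟩, rfl⟩, hu⟩
    exact piece_subset_UOB hC τ hu
  · intro u hu
    obtain ⟨c, w, τ, hlt, hc, rfl⟩ := exists_eq_reorder_colorTuple hu
    obtain ⟨C, hC⟩ := exists_vertexColor_eq c hc.flipAt
    obtain rfl : vertexColor C = c := funext fun s => funext fun i => hC s i
    refine ⟨_, ⟨(C, τ), ⟨⟨fun e => ?_, hc⟩, trivial⟩, rfl⟩, ?_⟩
    · obtain ⟨s, i, rfl⟩ := exists_edge_eq e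
      exact hlt s i
    · refine Set.mem_image_of_mem _ ?_
      rw [range_Phi]
      exact Set.mem_range_self w

/-- An irreducible set covered by finitely many closed sets lies in one of them; the bounded palette
provides the finiteness. -/
theorem exists_subset_piece {Z : Set (Tuples n)} (hZ : IsIrreducible Z) (h : Z ⊆ UOB n) :
    ∃ C τ, IsSeparating (vertexColor C) ∧ Z ⊆ piece C τ := by
  rw [← sUnion_pieces] at h
  obtain ⟨_, hW, hZW⟩ := isIrreducible_iff_sUnion_isClosed.1 hZ (finite_pieces n).toFinset
    (by
      intro W hW
      obtain ⟨a, _, rfl⟩ := (finite_pieces n).mem_toFinset.1 hW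
      exact isClosed_piece _ _)
    (by simpa using h)
  obtain ⟨a, ha, rfl⟩ := (finite_pieces n).mem_toFinset.1 hW
  exact ⟨a.1, a.2, ha.1.2, hZW⟩

/-! ### Irreducible components -/

theorem isIrreducible_preimage_val {X : Type*} [TopologicalSpace X] {S W : Set X}
    (hW : IsIrreducible W) (h : W ⊆ S) : IsIrreducible (Subtype.val ⁻¹' W : Set S) := by
  have : IrreducibleSpace W := isIrreducible_iff_irreducibleSpace.1 hW
  have h1 := (IrreducibleSpace.isIrreducible_univ W).image (Set.inclusion h)
    (continuous_inclusion h).continuousOn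
  rwa [Set.image_univ, Set.range_inclusion] at h1

theorem mem_components_iff {Z : Set (Tuples n)} :
    Z ∈ components n ↔ Maximal (fun W => IsIrreducible W ∧ W ⊆ UOB n) Z := by
  constructor
  · rintro ⟨Y, hY, rfl⟩
    refine ⟨⟨hY.1.image _ continuous_subtype_val.continuousOn, ?_⟩, ?_⟩
    · rintro _ ⟨y, _, rfl⟩
      exact y.2
    · rintro W ⟨hW, hWU⟩ hYW w hw
      exact ⟨⟨w, hWU hw⟩, hY.2 (isIrreducible_preimage_val hW hWU)
        (fun y hy => hYW ⟨y, hy, rfl⟩) hw, rfl⟩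
  · rintro ⟨⟨hZ, hZU⟩, hmax⟩
    refine ⟨Subtype.val ⁻¹' Z, ⟨isIrreducible_preimage_val hZ hZU, fun W hW hZW w hw => ?_⟩, ?_⟩
    · refine hmax ⟨hW.image _ continuous_subtype_val.continuousOn, ?_⟩ ?_ ⟨w, hw, rfl⟩
      · rintro _ ⟨y, _, rfl⟩
        exact y.2
      · exact fun z hz => ⟨⟨z, hZU hz⟩, hZW hz, rfl⟩
    · simpa using hZU

theorem exists_eq_piece {Z : Set (Tuples n)} (hZ : Z ∈ components n) :
    ∃ C τ, IsSeparating (vertexColor C) ∧ Z = piece C τ := by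
  have h := mem_components_iff.1 hZ
  obtain ⟨C, τ, hC, hsub⟩ := exists_subset_piece h.1.1 h.1.2
  exact ⟨C, τ, hC, hsub.antisymm (h.2 ⟨isIrreducible_piece C τ, piece_subset_UOB hC τ⟩ hsub)⟩

theorem topologicalKrullDim_Tuples_lt_top (n : ℕ) : topologicalKrullDim (Tuples n) < ⊤ :=
  (Tuples.isZariski n).topologicalKrullDim_lt_top

/-- An irreducible set containing this piece lies in another piece, which has no more colors and
hence no larger dimension, so the nested pieces coincide. -/
theorem piece_mem_maxComponents {C : Coloring n} (hC : IsSeparating (vertexColor C))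
    (hcard : (Set.range C).ncard + 1 = 2 ^ n) (τ : Equiv.Perm (Vertex n)) :
    piece C τ ∈ maxComponents n := by
  have hle : ∀ {D : Coloring n}, IsSeparating (vertexColor D) →
      (Set.range D).ncard ≤ (Set.range C).ncard := fun hD => by
    have := ncard_range_add_one_le hD
    omega
  refine ⟨mem_components_iff.2 ⟨⟨isIrreducible_piece C τ, piece_subset_UOB hC τ⟩, ?_⟩, ?_⟩
  · rintro W ⟨hW, hWU⟩ hsub
    obtain ⟨D, υ, hD, hWD⟩ := exists_subset_piece hW hWU
    have heq := eq_of_subset_of_topologicalKrullDim_le (topologicalKrullDim_Tuples_lt_top n)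
      (isClosed_piece C τ) (isIrreducible_piece D υ) (hsub.trans hWD)
      (topologicalKrullDim_piece_le (hle hD))
    exact hWD.trans heq.symm.subset
  · intro Y hY
    obtain ⟨D, υ, hD, rfl⟩ := exists_eq_piece hY
    exact topologicalKrullDim_piece_le (hle hD)

theorem mem_maxComponents_iff {Z : Set (Tuples n)} :
    Z ∈ maxComponents n ↔ ∃ (C : Coloring n) (σ : Equiv.Perm (Fin n)) (τ : Equiv.Perm (Vertex n)),
      IsAlgorithmic n C ∧ Z = piece (permute σ C) τ := by
  constructor
  · intro hZ
    obtain ⟨C, τ, hC, rfl⟩ := exists_eq_piece hZ.1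
    -- The color bound is attained by `A`, so a component with fewer colors would have smaller
    -- dimension than the piece of `A`.
    obtain ⟨A, hA⟩ := exists_isAlgorithmic n
    have hdim := hZ.2 _ (piece_mem_maxComponents hA.isSeparating hA.ncard_range 1).1
    have hcard : (Set.range C).ncard + 1 = 2 ^ n := by
      refine le_antisymm (ncard_range_add_one_le hC) ?_
      rw [← hA.ncard_range]
      by_contra hlt
      exact absurd hdim (not_le_of_gt (topologicalKrullDim_piece_lt (by omega)))
    obtain ⟨D, σ, hD, rfl⟩ := hC.exists_isAlgorithmic hcard
    exact ⟨D, σ, τ, hD, rfl⟩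
  · rintro ⟨C, σ, τ, hC, rfl⟩
    exact piece_mem_maxComponents (hC.isSeparating.permute σ)
      (by rw [range_permute]; exact hC.ncard_range) τ

/-! ### Permutation of the tensor factors -/

theorem permFactors_productState (σ : Equiv.Perm (Fin n)) (x : Fin n → ℙ ℂ Qubit) :
    permFactors σ (productState x) = productState fun i => x (σ.symm i) := by
  unfold permFactors productState
  rw [Projectivization.map_mk]
  congr 1
  ext s
  change (∏ i, (x i).rep (s (σ i))) = ∏ i, (x (σ.symm i)).rep (s i)
  exact Fintype.prod_equiv σ _ _ fun i => by rw [σ.symm_apply_apply]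

/-- Permuting the factors also permutes the coordinates of the labels; the change of labels is
absorbed into the order of the members. -/
theorem rearrange_colorTuple (σ : Equiv.Perm (Fin n)) (τ : Equiv.Perm (Vertex n))
    (C : Coloring n) (u : Config ℕ) :
    rearrange σ τ (colorTuple (vertexColor C) u) =
      reorder (τ.trans (σ.arrowCongr (Equiv.refl (Fin 2))))
        (colorTuple (vertexColor (permute σ C)) u) := by
  funext s
  have h : (τ s ∘ σ.symm) ∘ σ = τ s := by ext; simp
  change permFactors σ (productState _) = colorTuple (vertexColor (permute σ C)) u (τ s ∘ σ.symm)
  rw [permFactors_productState, colorTuple]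
  simp only [vertexColor_permute, h, Function.comp_apply]

theorem image_rearrange_range_Phi (σ : Equiv.Perm (Fin n)) (τ : Equiv.Perm (Vertex n))
    (C : Coloring n) :
    rearrange σ τ '' Set.range (Phi C) =
      piece (permute σ C) (τ.trans (σ.arrowCongr (Equiv.refl (Fin 2)))) := by
  unfold piece
  rw [range_Phi, range_Phi, ← Set.range_comp, ← Set.range_comp]
  exact congrArg Set.range (funext fun u => rearrange_colorTuple σ τ C u)

theorem piece_permute (σ : Equiv.Perm (Fin n)) (τ : Equiv.Perm (Vertex n)) (C : Coloring n) :
    piece (permute σ C) τ =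
      rearrange σ (τ.trans (σ.arrowCongr (Equiv.refl (Fin 2))).symm) '' Set.range (Phi C) := by
  rw [image_rearrange_range_Phi, Equiv.trans_assoc, Equiv.symm_trans_self, Equiv.trans_refl]

theorem mem_maxComponents_iff_rearrange {Z : Set (Tuples n)} :
    Z ∈ maxComponents n ↔ ∃ C : Coloring n, IsAlgorithmic n C ∧
      ∃ (σ : Equiv.Perm (Fin n)) (τ : Equiv.Perm (Vertex n)),
        Z = rearrange σ τ '' Set.range (Phi C) := by
  rw [mem_maxComponents_iff]
  constructor
  · rintro ⟨C, σ, τ, hC, rfl⟩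
    exact ⟨C, hC, σ, _, piece_permute σ τ C⟩
  · rintro ⟨C, hC, σ, τ, rfl⟩
    exact ⟨C, σ, _, hC, image_rearrange_range_Phi σ τ C⟩

/-! ### Gluing -/

theorem consState_productState (a : ℙ ℂ Qubit) (x : Fin n → ℙ ℂ Qubit) :
    consState a (productState x) = productState (Fin.cons a x : Fin (n + 1) → ℙ ℂ Qubit) := by
  obtain ⟨k, hk⟩ := Projectivization.exists_smul_eq_mk_rep ℂ (pureTensor fun i => (x i).rep)
    (pureTensor_ne_zero fun i => (x i).rep_nonzero)
  have hk' : (productState x).rep = (k : ℂ) • pureTensor fun i => (x i).rep := hk.symm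
  unfold consState
  conv_rhs => rw [productState]
  rw [Projectivization.mk_eq_mk_iff']
  refine ⟨k, ?_⟩
  ext s
  rw [hk']
  change (k : ℂ) * ∏ i, _ = a.rep (s 0) * ((k : ℂ) * ∏ i, (x i).rep (s i.succ))
  rw [Fin.prod_univ_succ]
  simp only [Fin.cons_zero, Fin.cons_succ]
  ring

theorem IsJoin.colorTuple_eq {r : ℕ} {C₀ C₁ : Coloring n} {C : Coloring (n + 1)}
    (h : IsJoin r C₀ C₁ C) (w : Config ℕ) :
    colorTuple (vertexColor C) w =
      glue (w r) (colorTuple (vertexColor C₀) w) (colorTuple (vertexColor C₁) w) := by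
  funext s
  unfold glue colorTuple
  rw [consState_productState, consState_productState]
  split_ifs with hs
  · congr 1
    funext i
    induction i using Fin.cases with
    | zero => simp [hs, (h s).1]
    | succ i =>
      simp only [(h s).2, hs, Fin.cons_succ, if_true]
      rfl
  · congr 1
    funext i
    induction i using Fin.cases with
    | zero => simp [hs, (h s).1]
    | succ i =>
      simp only [(h s).2, hs, Fin.cons_succ, if_false]
      rfl

/-- Restricting an assignment of states gives one inclusion for any join. The converse merges three
independent choices, which is possible because `r` and the two palettes do not meet. -/
theorem IsJoin.range_Phi_eq {r : ℕ} {C₀ C₁ : Coloring n} {C : Coloring (n + 1)}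
    (h : IsJoin r C₀ C₁ C) (hd : Disjoint (Set.range C₀) (Set.range C₁))
    (hr : r ∉ Set.range C₀ ∪ Set.range C₁) :
    Set.range (Phi C) = {w | ∃ a, ∃ u ∈ Set.range (Phi C₀), ∃ v ∈ Set.range (Phi C₁),
      w = glue a u v} := by
  simp only [range_Phi]
  apply Set.Subset.antisymm
  · rintro _ ⟨w, rfl⟩
    exact ⟨w r, _, ⟨w, rfl⟩, _, ⟨w, rfl⟩, h.colorTuple_eq w⟩
  · rintro _ ⟨a, _, ⟨u, rfl⟩, _, ⟨v, rfl⟩, rfl⟩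
    let w : Config ℕ := fun k => if k = r then a else if k ∈ Set.range C₀ then u k else v k
    refine ⟨w, ?_⟩
    rw [h.colorTuple_eq]
    congr 1
    · exact if_pos rfl
    · refine colorTuple_congr fun s i => ?_
      have hm : vertexColor C₀ s i ∈ Set.range C₀ := mem_range_iff.2 ⟨s, i, rfl⟩
      have hne : vertexColor C₀ s i ≠ r := fun h0 => hr (Or.inl (h0 ▸ hm))
      exact (if_neg hne).trans (if_pos hm)
    · refine colorTuple_congr fun s i => ?_
      have hm : vertexColor C₁ s i ∈ Set.range C₁ := mem_range_iff.2 ⟨s, i, rfl⟩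
      have hne : vertexColor C₁ s i ≠ r := fun h0 => hr (Or.inr (h0 ▸ hm))
      exact (if_neg hne).trans (if_neg (Set.disjoint_right.1 hd hm))

theorem range_Phi_permute_mem_maxComponents {C : Coloring n} (hC : IsAlgorithmic n C)
    (σ : Equiv.Perm (Fin n)) : Set.range (Phi (permute σ C)) ∈ maxComponents n := by
  refine mem_maxComponents_iff.2 ⟨C, σ, 1, hC, ?_⟩
  exact (Set.image_id _).symm

end Pieces

end Qubits

end

open Qubits
theorem theorem3 :
    (∀ (n : ℕ) (Z : Set (Tuples n)),
      Z ∈ maxComponents n ↔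
        ∃ C : Coloring n, IsAlgorithmic n C ∧
          ∃ (σ : Equiv.Perm (Fin n)) (τ : Equiv.Perm (Vertex n)),
            Z = rearrange σ τ '' Set.range (Phi C)) ∧
    (∀ (n : ℕ) (Z : Set (Tuples (n + 1))), Z ∈ maxComponents (n + 1) →
      ∃ (C₁ C₂ : Coloring n) (σ₁ σ₂ : Equiv.Perm (Fin n)) (B₁ B₂ : Set (Tuples n))
        (σ : Equiv.Perm (Fin (n + 1))) (τ : Equiv.Perm (Vertex (n + 1))),
        IsAlgorithmic n C₁ ∧ IsAlgorithmic n C₂ ∧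
        B₁ = Set.range (Phi (permute σ₁ C₁)) ∧ B₂ = Set.range (Phi (permute σ₂ C₂)) ∧
        B₁ ∈ maxComponents n ∧ B₂ ∈ maxComponents n ∧
        Z = rearrange σ τ '' {w | ∃ a, ∃ u ∈ B₁, ∃ v ∈ B₂, w = glue a u v}) := by
  refine ⟨fun n Z => mem_maxComponents_iff_rearrange, fun n Z hZ => ?_⟩
  obtain ⟨C, ⟨C₁, C₂, σ₁, σ₂, r, h₁, h₂, hd, hr, hj⟩, σ, τ, rfl⟩ :=
    mem_maxComponents_iff_rearrange.1 hZ
  refine ⟨C₁, C₂, σ₁, σ₂, _, _, σ, τ, h₁, h₂, rfl, rfl,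
    range_Phi_permute_mem_maxComponents h₁ σ₁, range_Phi_permute_mem_maxComponents h₂ σ₂, ?_⟩
  rw [hj.range_Phi_eq (by rwa [range_permute, range_permute])
    (by rwa [range_permute, range_permute])]
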